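/- Let $K$ be a finite geometric simplicial complex in $\mathbb{R}^2$ whose underlying set $|K|$ is homeomorphic to the closed unit disk (a triangulated polygon), and consider the subcomplex of those simplices of $K$ that are contained in the topological boundary of $|K|$. Suppose that some simplices of this subcomplex (vertices and edges) are identified with each other: an identification matches two simplices of the same dimension through a bijection between their vertices; the relation formed by these identifications is an equivalence relation (reflexive, symmetric and transitive, as a relation between ordered simplices); it is compatible with passing to faces and with reordering the vertices; and no simplex is identified with itself by a nontrivial permutation of its vertices. No identification at all is allowed as a special case. Denote by $K_0$ the boundary of $K$ with these identifications, and let $\chi = n_0 - n_1 + n_2$, where $n_i$ is the number of $i$-dimensional simplices, simplices identified with each other being counted as one, both in $K$ and in $K_0$. Then $$\chi(K) = \chi(K_0) + 1.$$ -/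

import Mathlib

/-- The Euclidean plane. -/
abbrev Plane : Type := EuclideanSpace ℝ (Fin 2)

namespace PlanarComplex

/-- The boundary of a (geometric) simplicial complex `K` in the plane: the subcomplex of all
simplices of `K` that lie in the topological boundary of the underlying set `|K|`. -/
def boundary (K : Geometry.SimplicialComplex ℝ Plane) : Geometry.SimplicialComplex ℝ Plane where
  faces := {s | s ∈ K.faces ∧ convexHull ℝ (s : Set Plane) ⊆ frontier K.space}
  isRelLowerSet_faces := by
    intro s hs
    refine ⟨K.nonempty_of_mem_faces hs.1, fun t hts ht => ⟨K.down_closed hs.1 hts ht, ?_⟩⟩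
    exact (convexHull_mono (Finset.coe_subset.mpr hts)).trans hs.2
  indep := fun hs => K.indep hs.1
  inter_subset_convexHull := fun hs ht => K.inter_subset_convexHull hs.1 ht.1

/-- An ordering `(v 0, …, v n)` of the vertices of an `n`-simplex is an injective map
`v : Fin (n + 1) ↪ Plane`; this is the simplex that it orders, as a set of vertices. -/
def simplexOf {n : ℕ} (v : Fin (n + 1) ↪ Plane) : Finset Plane :=
  Finset.univ.map v

/-- Identifications of the simplices of a simplicial complex `L`. Two simplices of the same
dimension may be identified by a bijection between their vertices (equivalently, by the affine
isomorphism which extends it). So `rel v w` says: the simplex `[v 0, …, v n]` is identified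
with the simplex `[w 0, …, w n]` in such a way that `v i` goes to `w i` for all `i`. -/
structure Identification (L : Geometry.SimplicialComplex ℝ Plane) where
  /-- the ordered simplices `v` and `w` are identified -/
  rel : ∀ {n : ℕ}, (Fin (n + 1) ↪ Plane) → (Fin (n + 1) ↪ Plane) → Prop
  /-- only simplices of `L` take part -/
  mem_faces : ∀ {n : ℕ} {v w : Fin (n + 1) ↪ Plane}, rel v w → simplexOf v ∈ L.faces
  refl : ∀ {n : ℕ} {v : Fin (n + 1) ↪ Plane}, simplexOf v ∈ L.faces → rel v v
  symm : ∀ {n : ℕ} {v w : Fin (n + 1) ↪ Plane}, rel v w → rel w v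
  trans : ∀ {n : ℕ} {u v w : Fin (n + 1) ↪ Plane}, rel u v → rel v w → rel u w
  /-- an identification of two simplices identifies corresponding faces, and does not depend on
  the order in which the vertices are listed -/
  restrict : ∀ {m n : ℕ} {v w : Fin (n + 1) ↪ Plane} (f : Fin (m + 1) ↪ Fin (n + 1)),
    rel v w → rel (f.trans v) (f.trans w)
  /-- no simplex is identified with itself by a nontrivial permutation of its vertices (so no
  edge is folded) -/
  no_fold : ∀ {n : ℕ} {v : Fin (n + 1) ↪ Plane} (σ : Equiv.Perm (Fin (n + 1))),
    rel v (σ.toEmbedding.trans v) → σ = 1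

/-- If two orderings list the same simplex, they differ by an injective reindexing. -/
theorem exists_reindex {m n : ℕ} {v : Fin (m + 1) ↪ Plane} {w : Fin (n + 1) ↪ Plane}
    (h : simplexOf v = simplexOf w) : ∃ f : Fin (m + 1) ↪ Fin (n + 1), f.trans w = v := by
  have key : ∀ i, ∃ j, w j = v i := by
    intro i
    have hi : v i ∈ simplexOf w := by
      rw [← h]
      simp [simplexOf]
    simpa [simplexOf] using hi
  choose f hf using key
  refine ⟨⟨f, fun a b hab => v.injective ?_⟩, ?_⟩
  · rw [← hf a, ← hf b, hab]
  · ext1 i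
    exact hf i

/-- The equivalence relation "identified with each other" on simplices (as vertex sets) given by
an identification of simplices of `L`. A simplex that is not in `L` is equivalent only to
itself. -/
def Identification.simplexSetoid {L : Geometry.SimplicialComplex ℝ Plane}
    (I : Identification L) : Setoid (Finset Plane) where
  r s t := s = t ∨
    ∃ (n : ℕ) (v w : Fin (n + 1) ↪ Plane), simplexOf v = s ∧ simplexOf w = t ∧ I.rel v w
  iseqv := by
    refine ⟨fun s => Or.inl rfl, ?_, ?_⟩
    · rintro s t (h | ⟨n, v, w, hv, hw, h⟩)
      · exact Or.inl h.symm
      · exact Or.inr ⟨n, w, v, hw, hv, I.symm h⟩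
    · rintro s t u (rfl | ⟨n, v, w, hv, hw, h⟩) (rfl | ⟨m, v', w', hv', hw', h'⟩)
      · exact Or.inl rfl
      · exact Or.inr ⟨m, v', w', hv', hw', h'⟩
      · exact Or.inr ⟨n, v, w, hv, hw, h⟩
      · obtain ⟨f, hf⟩ := exists_reindex (hw.trans hv'.symm)
        obtain ⟨g, hg⟩ := exists_reindex (hv'.trans hw.symm)
        have hmn : m = n := by
          have h1 := Fintype.card_le_of_embedding f
          have h2 := Fintype.card_le_of_embedding g
          simp only [Fintype.card_fin] at h1 h2
          omega
        subst hmn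
        refine Or.inr ⟨m, v, f.trans w', hv, ?_, I.trans h ?_⟩
        · rw [← hw']
          have hb : Function.Bijective f := Finite.injective_iff_bijective.mp f.injective
          ext x
          simp only [simplexOf, Finset.mem_map, Finset.mem_univ, true_and,
            Function.Embedding.trans_apply]
          exact (hb.surjective.exists (p := fun a => w' a = x)).symm
        · rw [← hf]
          exact I.restrict f h'

/-- The number of `k`-dimensional simplices of `M`, where simplices that are equivalent under
`r` are counted as one. -/
noncomputable def numSimplices (M : Geometry.SimplicialComplex ℝ Plane)
    (r : Setoid (Finset Plane)) (k : ℕ) : ℕ :=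
  (Quotient.mk r '' {s | s ∈ M.faces ∧ s.card = k + 1}).ncard

/-- `χ = n₀ - n₁ + n₂` for a complex in the plane, where simplices that are equivalent under `r`
are counted as one. -/
noncomputable def eulerChar (M : Geometry.SimplicialComplex ℝ Plane)
    (r : Setoid (Finset Plane)) : ℤ :=
  (numSimplices M r 0 : ℤ) - (numSimplices M r 1 : ℤ) + (numSimplices M r 2 : ℤ)

end PlanarComplex

namespace PlanarComplex

open Topology

/-! Identifications only touch boundary simplices, so a simplex off the boundary is alone in its
class and the difference of the two characteristics does not depend on them (`numSimplices_eq`). It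
remains to treat the case without identifications: the disk has characteristic 1
(`IsDiskLike.euler`), and its boundary has characteristic 0, because it has as many vertices as
edges (`IsDiskLike.ncard_boundary`) and no triangles.

The homeomorphism with the disk enters through `IsDiskLike`: no point disconnects the space, and
every map to the circle lifts to the line. The lifting property makes simplicial 1-cocycles
coboundaries (`exists_potential`). The characteristic is then the alternating sum of dimensions in
the rational cochain complex: constants in degree 0, exactness in degree 1, and surjectivity onto
2-cochains, as a nonzero 2-cycle would be supported on a closed surface in the plane
(`not_forall_edge_exists_ne`).

For the boundary it suffices that every boundary vertex lies on exactly two boundary edges. Counting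
incident edge-triangle pairs around the vertex shows that their number is even; connectedness of the
link (`link_connected`) bounds it by two; and with no boundary edge the vertex would be an interior
point (`vertex_mem_interior`). -/

variable {K : Geometry.SimplicialComplex ℝ Plane} {S : Set Plane}

/-! ### Affine coordinates on simplices -/

/-- An affine map commutes with weighted sums of total weight one. -/
theorem affineMap_sum_smul {E F : Type*} [AddCommGroup E] [Module ℝ E] [AddCommGroup F]
    [Module ℝ F] (φ : E →ᵃ[ℝ] F) (s : Finset E) (w : E → ℝ) (hw : ∑ v ∈ s, w v = 1) :
    φ (∑ v ∈ s, w v • v) = ∑ v ∈ s, w v • φ v := by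
  have h : ∀ x, φ x = φ.linear x + φ 0 := fun x => congrFun φ.decomp x
  rw [h, map_sum]
  simp_rw [map_smul]
  have h' : ∑ v ∈ s, w v • φ v = ∑ v ∈ s, (w v • φ.linear v + w v • φ 0) :=
    Finset.sum_congr rfl fun v _ => by rw [h v, smul_add]
  rw [h', Finset.sum_add_distrib, ← Finset.sum_smul, hw, one_smul]

/-- Affinely independent points admit affine coordinate functions. -/
theorem exists_coord (s : Finset Plane) (hs : AffineIndependent ℝ ((↑) : s → Plane)) :
    ∃ L : Plane → (Plane →ᵃ[ℝ] ℝ), ∀ v ∈ s, ∀ w ∈ s, L v w = if v = w then 1 else 0 := by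
  classical
  -- The vertices are completed to an affine basis of the plane, whose barycentric coordinates
  -- serve.
  obtain ⟨t, hst, ht, hspan⟩ := exists_subset_affineIndependent_affineSpan_eq_top
    (k := ℝ) (V := Plane) (P := Plane) (s := (s : Set Plane)) hs
  let b : AffineBasis t ℝ Plane := ⟨(↑), ht, by simpa using hspan⟩
  refine ⟨fun v => if h : v ∈ t then b.coord ⟨v, h⟩ else AffineMap.const ℝ Plane 0, ?_⟩
  intro v hv w hw
  have hv' : v ∈ t := hst hv
  have hw' : w ∈ t := hst hw
  have hb : b ⟨w, hw'⟩ = w := rfl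
  have := b.coord_apply ⟨v, hv'⟩ ⟨w, hw'⟩
  rw [hb] at this
  simp only [hv', dif_pos, this, Subtype.mk.injEq]

/-- Affine coordinate functions attached to the vertices of a simplex. -/
noncomputable def coord (s : Finset Plane) : Plane → (Plane →ᵃ[ℝ] ℝ) :=
  Classical.epsilon fun L => ∀ v ∈ s, ∀ w ∈ s, L v w = if v = w then 1 else 0

theorem coord_apply {s : Finset Plane} (hs : AffineIndependent ℝ ((↑) : s → Plane)) {v w : Plane}
    (hv : v ∈ s) (hw : w ∈ s) : coord s v w = if v = w then 1 else 0 :=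
  Classical.epsilon_spec (exists_coord s hs) v hv w hw

theorem coord_self {s : Finset Plane} (hs : AffineIndependent ℝ ((↑) : s → Plane)) {v : Plane}
    (hv : v ∈ s) : coord s v v = 1 := by
  rw [coord_apply hs hv hv, if_pos rfl]

theorem coord_ne {s : Finset Plane} (hs : AffineIndependent ℝ ((↑) : s → Plane)) {v w : Plane}
    (hv : v ∈ s) (hw : w ∈ s) (h : v ≠ w) : coord s v w = 0 := by
  rw [coord_apply hs hv hw, if_neg h]

theorem continuous_affine (φ : Plane →ᵃ[ℝ] ℝ) : Continuous φ :=
  φ.continuous_of_finiteDimensional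

theorem coord_sum_smul {s : Finset Plane} (hs : AffineIndependent ℝ ((↑) : s → Plane))
    {w : Plane → ℝ} (hw : ∑ v ∈ s, w v = 1) {v : Plane} (hv : v ∈ s) :
    coord s v (∑ u ∈ s, w u • u) = w v := by
  rw [affineMap_sum_smul _ _ _ hw, Finset.sum_eq_single v]
  · rw [coord_self hs hv, smul_eq_mul, mul_one]
  · intro u hu huv
    rw [coord_ne hs hv hu huv.symm, smul_zero]
  · exact fun h => absurd hv h

theorem exists_weights {s : Finset Plane} (hs : AffineIndependent ℝ ((↑) : s → Plane))
    (h3 : s.card = 3) (x : Plane) : ∃ w : Plane → ℝ, ∑ v ∈ s, w v = 1 ∧ ∑ v ∈ s, w v • v = x := by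
  classical
  have htop : affineSpan ℝ (Set.range ((↑) : s → Plane)) = ⊤ := by
    rw [hs.affineSpan_eq_top_iff_card_eq_finrank_add_one]
    simp [h3]
  obtain ⟨w, hw, hx⟩ := eq_affineCombination_of_mem_affineSpan_of_fintype
    (k := ℝ) (p := ((↑) : s → Plane)) (p1 := x) (by rw [htop]; trivial)
  rw [Finset.affineCombination_eq_linear_combination _ _ _ hw] at hx
  refine ⟨fun v => if h : v ∈ s then w ⟨v, h⟩ else 0, ?_, ?_⟩
  · rw [← hw, ← Finset.sum_coe_sort s]
    simp
  · rw [hx, ← Finset.sum_coe_sort s]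
    simp

theorem sum_coord {s : Finset Plane} (hs : AffineIndependent ℝ ((↑) : s → Plane))
    (h3 : s.card = 3) (x : Plane) : ∑ v ∈ s, coord s v x = 1 := by
  obtain ⟨w, hw, rfl⟩ := exists_weights hs h3 x
  rw [← hw]
  exact Finset.sum_congr rfl fun v hv => coord_sum_smul hs hw hv

theorem sum_coord_smul {s : Finset Plane} (hs : AffineIndependent ℝ ((↑) : s → Plane))
    (h3 : s.card = 3) (x : Plane) : ∑ v ∈ s, coord s v x • v = x := by
  obtain ⟨w, hw, rfl⟩ := exists_weights hs h3 x
  exact Finset.sum_congr rfl fun v hv => by rw [coord_sum_smul hs hw hv]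

theorem affineMap_eq_sum {s : Finset Plane} (hs : AffineIndependent ℝ ((↑) : s → Plane))
    (h3 : s.card = 3) (φ : Plane →ᵃ[ℝ] ℝ) (x : Plane) : φ x = ∑ v ∈ s, coord s v x * φ v := by
  conv_lhs => rw [← sum_coord_smul hs h3 x]
  rw [affineMap_sum_smul _ _ _ (sum_coord hs h3 x)]
  rfl

theorem mem_convexHull_iff_coord {s : Finset Plane}
    (hs : AffineIndependent ℝ ((↑) : s → Plane)) (h3 : s.card = 3) (x : Plane) :
    x ∈ convexHull ℝ (s : Set Plane) ↔ ∀ v ∈ s, 0 ≤ coord s v x := by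
  rw [Finset.mem_convexHull']
  constructor
  · rintro ⟨w, h0, hw, rfl⟩ v hv
    rw [coord_sum_smul hs hw hv]
    exact h0 v hv
  · exact fun h => ⟨_, h, sum_coord hs h3 x, sum_coord_smul hs h3 x⟩

theorem affineMap_eq_zero_of_mem_convexHull {φ : Plane →ᵃ[ℝ] ℝ} {s : Set Plane}
    (h : ∀ v ∈ s, φ v = 0) {x : Plane} (hx : x ∈ convexHull ℝ s) : φ x = 0 := by
  have hc : Convex ℝ (φ ⁻¹' {0}) := (convex_singleton 0).affine_preimage φ
  exact convexHull_min (fun v hv => h v hv) hc hx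

theorem isClosed_convexHull_finset (s : Finset Plane) :
    IsClosed (convexHull ℝ (s : Set Plane)) :=
  s.finite_toSet.isClosed_convexHull ℝ

/-! ### Triangles sharing an edge -/

/-- The coordinates of two triangles that share an edge, at the opposite vertices, are
proportional. -/
theorem coord_eq_mul_coord {t₁ t₂ e : Finset Plane} {c d : Plane}
    (h₁ : AffineIndependent ℝ ((↑) : t₁ → Plane)) (h₂ : AffineIndependent ℝ ((↑) : t₂ → Plane))
    (h₂3 : t₂.card = 3) (hc : c ∉ e) (hd : d ∉ e) (hce : insert c e = t₁) (hde : insert d e = t₂)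
    (x : Plane) : coord t₁ c x = coord t₁ c d * coord t₂ d x := by
  rw [affineMap_eq_sum h₂ h₂3 (coord t₁ c) x]
  conv_lhs => rw [← hde]
  rw [Finset.sum_insert hd, hde, Finset.sum_eq_zero, add_zero, mul_comm]
  intro v hv
  rw [coord_ne h₁ (hce ▸ Finset.mem_insert_self _ _) (hce ▸ Finset.mem_insert_of_mem hv)
    (fun h => hc (by rwa [h])), mul_zero]

/-- Two triangles of a complex that share an edge lie on opposite sides of it. -/
theorem coord_opposite_neg {t₁ t₂ e : Finset Plane} {c d : Plane} (ht₁ : t₁ ∈ K.faces)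
    (ht₂ : t₂ ∈ K.faces) (h₁3 : t₁.card = 3) (h₂3 : t₂.card = 3) (hc : c ∉ e) (hd : d ∉ e)
    (hce : insert c e = t₁) (hde : insert d e = t₂) (hcd : c ≠ d) : coord t₁ c d < 0 := by
  classical
  have h₁ := K.indep ht₁
  have h₂ := K.indep ht₂
  have hct : c ∈ t₁ := hce ▸ Finset.mem_insert_self _ _
  have hdt : d ∈ t₂ := hde ▸ Finset.mem_insert_self _ _
  have key := coord_eq_mul_coord h₁ h₂ h₂3 hc hd hce hde
  by_contra! hneg
  have hne : coord t₁ c d ≠ 0 := by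
    intro h0
    have := key c
    rw [coord_self h₁ hct, h0, zero_mul] at this
    exact one_ne_zero this
  have hpos : 0 < coord t₁ c d := lt_of_le_of_ne hneg hne.symm
  have he2 : e.card = 2 := by
    have := Finset.card_insert_of_notMem hc
    rw [hce, h₁3] at this
    omega
  obtain ⟨a, b, hab, rfl⟩ := Finset.card_eq_two.mp he2
  have hat : ∀ v ∈ ({a, b} : Finset Plane), v ∈ t₂ := fun v hv =>
    hde ▸ Finset.mem_insert_of_mem hv
  have hat₁ : ∀ v ∈ ({a, b} : Finset Plane), v ∈ t₁ := fun v hv =>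
    hce ▸ Finset.mem_insert_of_mem hv
  -- If `c` and `d` were on the same side of the edge, a point slightly off its midpoint towards `c`
  -- would lie in both triangles. It would then lie in the hull of their common vertices, where
  -- `coord t₁ c` vanishes.
  let m := midpoint ℝ a b
  have hm : m ∈ convexHull ℝ (t₁ : Set Plane) :=
    (convex_convexHull ℝ _).midpoint_mem (subset_convexHull _ _ (hat₁ a (by simp)))
      (subset_convexHull _ _ (hat₁ b (by simp)))
  have hmid : ∀ φ : Plane →ᵃ[ℝ] ℝ, φ m = (φ a + φ b) / 2 := by
    intro φ
    rw [show m = midpoint ℝ a b from rfl, φ.map_midpoint, midpoint_eq_smul_add]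
    simp; ring
  have hcont : Continuous fun ε : ℝ => AffineMap.lineMap m c ε :=
    AffineMap.lineMap_continuous
  have hev : ∀ v ∈ ({a, b} : Finset Plane),
      ∀ᶠ ε in nhdsWithin (0 : ℝ) (Set.Ioi 0), 0 < coord t₂ v (AffineMap.lineMap m c ε) := by
    intro v hv
    have hc' : Continuous fun ε : ℝ => coord t₂ v (AffineMap.lineMap m c ε) :=
      (continuous_affine _).comp hcont
    have h0 : 0 < coord t₂ v (AffineMap.lineMap m c (0 : ℝ)) := by
      rw [AffineMap.lineMap_apply_zero, hmid, coord_apply h₂ (hat v hv) (hat a (by simp)),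
        coord_apply h₂ (hat v hv) (hat b (by simp))]
      simp only [Finset.mem_insert, Finset.mem_singleton] at hv
      rcases hv with rfl | rfl
      · rw [if_pos rfl, if_neg hab]; norm_num
      · rw [if_pos rfl, if_neg hab.symm]; norm_num
    exact nhdsWithin_le_nhds (hc'.continuousAt.eventually (lt_mem_nhds h0))
  have hlt1 : ∀ᶠ ε in nhdsWithin (0 : ℝ) (Set.Ioi 0), ε < 1 :=
    nhdsWithin_le_nhds (gt_mem_nhds one_pos)
  have hgt0 : ∀ᶠ ε in nhdsWithin (0 : ℝ) (Set.Ioi 0), 0 < ε := self_mem_nhdsWithin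
  obtain ⟨ε, ⟨⟨ha, hb⟩, h1⟩, h0⟩ :=
    (((hev a (by simp)).and (hev b (by simp))).and hlt1).and hgt0 |>.exists
  set x : Plane := AffineMap.lineMap m c ε with hx
  have hcm : coord t₁ c m = 0 := by
    rw [hmid, coord_ne h₁ hct (hat₁ a (by simp)) (fun h => hc (by simp [h])),
      coord_ne h₁ hct (hat₁ b (by simp)) (fun h => hc (by simp [h]))]
    simp
  have hcx : coord t₁ c x = ε := by
    rw [hx, AffineMap.apply_lineMap, hcm, coord_self h₁ hct, AffineMap.lineMap_apply]
    simp
  have hx₁ : x ∈ convexHull ℝ (t₁ : Set Plane) :=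
    (convex_convexHull ℝ _).lineMap_mem hm (subset_convexHull _ _ hct) ⟨h0.le, h1.le⟩
  have hx₂ : x ∈ convexHull ℝ (t₂ : Set Plane) := by
    rw [mem_convexHull_iff_coord h₂ h₂3]
    intro v hv
    rw [← hde, Finset.mem_insert, Finset.mem_insert, Finset.mem_singleton] at hv
    rcases hv with rfl | rfl | rfl
    · have := key x
      rw [hcx] at this
      have hp : 0 < coord t₁ c v * coord t₂ v x := this ▸ h0
      exact (pos_of_mul_pos_right hp hpos.le).le
    · exact ha.le
    · exact hb.le
  have hx₃ := K.inter_subset_convexHull ht₁ ht₂ ⟨hx₁, hx₂⟩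
  have : coord t₁ c x = 0 := by
    refine affineMap_eq_zero_of_mem_convexHull ?_ hx₃
    rintro v ⟨hv₁, hv₂⟩
    refine coord_ne h₁ hct hv₁ ?_
    rintro rfl
    rw [Finset.mem_coe, ← hde, Finset.mem_insert] at hv₂
    exact hv₂.elim hcd hc
  rw [hcx] at this
  exact h0.ne' this

/-! ### Topology of the plane and of the disk -/

theorem one_lt_rank_plane : 1 < Module.rank ℝ Plane := by
  rw [← Module.finrank_eq_rank]
  simp

/-- A ball in the plane minus a countable set is preconnected. -/
theorem isPreconnected_ball_diff (c : Plane) {r : ℝ} (hr : 0 < r) {s : Set Plane}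
    (hs : s.Countable) : IsPreconnected (Metric.ball c r \ s) := by
  -- `φ` parametrizes the ball by the whole plane, where complements of countable sets are
  -- connected.
  let φ := OpenPartialHomeomorph.univBall c r
  have hsrc : φ.source = Set.univ := OpenPartialHomeomorph.univBall_source c r
  have hinj : Function.Injective φ := fun x y h =>
    φ.injOn (hsrc ▸ Set.mem_univ x) (hsrc ▸ Set.mem_univ y) h
  have hcont : Continuous φ := OpenPartialHomeomorph.continuous_univBall c r
  have hcount : (φ ⁻¹' s).Countable := hs.preimage hinj
  have himg : Metric.ball c r \ s = φ '' (φ ⁻¹' s)ᶜ := by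
    have hball : φ '' Set.univ = Metric.ball c r := by
      rw [← hsrc, φ.image_source_eq_target, OpenPartialHomeomorph.univBall_target c hr]
    rw [← Set.preimage_compl, Set.image_preimage_eq_inter_range, ← Set.image_univ, hball,
      Set.sdiff_eq, Set.inter_comm]
  rw [himg]
  exact ((hcount.isConnected_compl_of_one_lt_rank one_lt_rank_plane).isPreconnected).image _
    hcont.continuousOn

/-- The closed unit disk minus a point is preconnected. -/
theorem isPreconnected_closedBall_diff_singleton (p : Plane) :
    IsPreconnected (Metric.closedBall (0 : Plane) 1 \ {p}) := by
  refine (isPreconnected_ball_diff 0 one_pos (Set.countable_singleton p)).subset_closure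
    (Set.sdiff_subset_sdiff_left Metric.ball_subset_closedBall) ?_
  rintro x ⟨hx, hxp⟩
  rw [← closure_ball (0 : Plane) one_ne_zero] at hx
  rw [Set.sdiff_eq]
  exact (isOpen_compl_singleton.closure_inter (t := {p}ᶜ)) ⟨hx, hxp⟩

theorem isPreconnected_diff_singleton_of_homeomorph
    (h : S ≃ₜ Metric.closedBall (0 : Plane) 1) (p : Plane) : IsPreconnected (S \ {p}) := by
  let f : Metric.closedBall (0 : Plane) 1 → Plane := fun x => (h.symm x : Plane)
  have hf : Continuous f := continuous_subtype_val.comp h.symm.continuous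
  have hfinj : Function.Injective f := Subtype.val_injective.comp h.symm.injective
  have key : ∀ q : Plane,
      IsPreconnected {x : Metric.closedBall (0 : Plane) 1 | (x : Plane) ≠ q} := by
    intro q
    rw [← Topology.IsInducing.subtypeVal.isPreconnected_image]
    convert isPreconnected_closedBall_diff_singleton q using 1
    ext x
    simp [and_comm]
  by_cases hp : p ∈ S
  · have himg : S \ {p} =
        f '' {x : Metric.closedBall (0 : Plane) 1 | (x : Plane) ≠ h ⟨p, hp⟩} := by
      ext x
      constructor
      · rintro ⟨hx, hxp⟩
        refine ⟨h ⟨x, hx⟩, ?_, by simp [f]⟩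
        intro heq
        have := h.injective (Subtype.ext heq)
        exact hxp (congrArg Subtype.val this)
      · rintro ⟨y, hy, rfl⟩
        refine ⟨(h.symm y).2, ?_⟩
        intro heq
        apply hy
        have : h.symm y = ⟨p, hp⟩ := Subtype.ext heq
        rw [← this, h.apply_symm_apply]
    rw [himg]
    exact (key _).image _ hf.continuousOn
  · rw [Set.sdiff_singleton_eq_self hp]
    -- Here nothing has to be removed, so `key` is applied to a point of norm 2, which is outside
    -- the disk.
    have himg : S = f '' {x : Metric.closedBall (0 : Plane) 1 |
        (x : Plane) ≠ EuclideanSpace.single 0 2} := by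
      ext x
      constructor
      · intro hx
        refine ⟨h ⟨x, hx⟩, ?_, by simp [f]⟩
        intro heq
        have h1 := (h ⟨x, hx⟩).2
        rw [heq, mem_closedBall_zero_iff, PiLp.norm_single] at h1
        norm_num at h1
      · rintro ⟨y, -, rfl⟩
        exact (h.symm y).2
    rw [himg]
    exact (key _).image _ hf.continuousOn

theorem nontrivial_of_homeomorph (h : S ≃ₜ Metric.closedBall (0 : Plane) 1) :
    S.Nontrivial := by
  let a : Metric.closedBall (0 : Plane) 1 := ⟨0, by simp⟩
  let b : Metric.closedBall (0 : Plane) 1 := ⟨EuclideanSpace.single 0 1, by simp⟩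
  refine ⟨h.symm a, (h.symm a).2, h.symm b, (h.symm b).2, fun hab => ?_⟩
  have := congrArg Subtype.val (h.symm.injective (Subtype.ext hab))
  have h0 := congrArg (fun v : Plane => v 0) this
  simp [a, b] at h0

/-- Maps from a disk to the circle lift to the line. -/
theorem exists_lift_of_homeomorph (h : S ≃ₜ Metric.closedBall (0 : Plane) 1)
    (f : C(S, AddCircle (1 : ℝ))) : ∃ G : C(S, ℝ), ∀ x, ((G x : ℝ) : AddCircle (1 : ℝ)) = f x := by
  -- Radial retraction onto the disk: it extends the map to the whole plane, which is simply
  -- connected, so the extension lifts through the covering of the circle by the line.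
  let r : Plane → Plane := fun x => (max 1 ‖x‖)⁻¹ • x
  have hpos : ∀ x : Plane, 0 < max 1 ‖x‖ := fun x => lt_max_of_lt_left one_pos
  have hr : Continuous r :=
    ((continuous_const.max continuous_norm).inv₀ fun x => (hpos x).ne').smul continuous_id
  have hmem : ∀ x, r x ∈ Metric.closedBall (0 : Plane) 1 := by
    intro x
    rw [mem_closedBall_zero_iff, norm_smul, norm_inv, Real.norm_of_nonneg (hpos x).le,
      inv_mul_le_iff₀ (hpos x), mul_one]
    exact le_max_right _ _
  have hid : ∀ x ∈ Metric.closedBall (0 : Plane) 1, r x = x := by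
    intro x hx
    rw [mem_closedBall_zero_iff] at hx
    simp [r, max_eq_left hx]
  let F : C(Plane, AddCircle (1 : ℝ)) :=
    ⟨fun x => f (h.symm ⟨r x, hmem x⟩),
      f.continuous.comp (h.symm.continuous.comp (hr.subtype_mk hmem))⟩
  obtain ⟨e₀, he₀⟩ := QuotientAddGroup.mk_surjective (F 0)
  obtain ⟨G, ⟨-, hG⟩, -⟩ := (AddCircle.isCoveringMap_coe (1 : ℝ)).existsUnique_continuousMap_lifts
    F 0 e₀ he₀
  refine ⟨⟨fun x => G (h x), G.continuous.comp (continuous_subtype_val.comp h.continuous)⟩, ?_⟩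
  intro x
  have := congrFun hG (h x : Plane)
  simp only [Function.comp_apply] at this
  simp only [ContinuousMap.coe_mk]
  rw [this]
  simp only [F, ContinuousMap.coe_mk]
  congr 1
  rw [Homeomorph.symm_apply_eq]
  exact Subtype.ext (hid _ (h x).2)

/-! ### Unions of triangles -/

theorem exists_insert_eq {e t : Finset Plane} (h : e ⊆ t) (he : e.card = 2) (ht : t.card = 3) :
    ∃ c, c ∉ e ∧ insert c e = t := by
  classical
  obtain ⟨c, hc, h'⟩ := Finset.exists_eq_insert_iff.mpr ⟨h, by omega⟩
  exact ⟨c, hc, h'⟩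

/-- A point of a union of triangles is interior if it is not a vertex and every edge through it
lies in two of the triangles. -/
theorem iUnion_triangles_mem_nhds {Z : Set (Finset Plane)}
    (hZ : ∀ t ∈ Z, t ∈ K.faces ∧ t.card = 3) {x : Plane} {t : Finset Plane} (ht : t ∈ Z)
    (hx : x ∈ convexHull ℝ (t : Set Plane)) (hxt : x ∉ t)
    (hedge : ∀ e ⊆ t, e.card = 2 → x ∈ convexHull ℝ (e : Set Plane) →
      ∃ t' ∈ Z, t' ≠ t ∧ e ⊆ t') :
    (⋃ t ∈ Z, convexHull ℝ (t : Set Plane)) ∈ 𝓝 x := by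
  classical
  obtain ⟨htK, ht3⟩ := hZ t ht
  have hti := K.indep htK
  have hx0 := (mem_convexHull_iff_coord hti ht3 x).mp hx
  by_cases hpos : ∀ v ∈ t, 0 < coord t v x
  · have : ∀ᶠ y in 𝓝 x, ∀ v ∈ t, 0 < coord t v y :=
      (Filter.eventually_all_finset t).mpr fun v hv =>
        (continuous_affine (coord t v)).continuousAt.eventually (lt_mem_nhds (hpos v hv))
    filter_upwards [this] with y hy
    exact Set.mem_biUnion ht ((mem_convexHull_iff_coord hti ht3 y).mpr fun v hv => (hy v hv).le)
  -- Now `x` lies on the edge opposite to `c`, in its relative interior since `x` is not a vertex.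
  push Not at hpos
  obtain ⟨c, hc, hc0⟩ := hpos
  have hcx : coord t c x = 0 := le_antisymm hc0 (hx0 c hc)
  have hsum := sum_coord hti ht3 x
  have hsmul := sum_coord_smul hti ht3 x
  rw [← Finset.add_sum_erase t _ hc, hcx, zero_add] at hsum
  rw [← Finset.add_sum_erase t _ hc, hcx, zero_smul, zero_add] at hsmul
  have he2 : (t.erase c).card = 2 := by rw [Finset.card_erase_of_mem hc, ht3]
  have hxe : x ∈ convexHull ℝ ((t.erase c : Finset Plane) : Set Plane) :=
    Finset.mem_convexHull'.mpr
      ⟨_, fun v hv => hx0 v (Finset.mem_of_mem_erase hv), hsum, hsmul⟩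
  have hepos : ∀ v ∈ t.erase c, 0 < coord t v x := by
    intro v hv
    refine lt_of_le_of_ne (hx0 v (Finset.mem_of_mem_erase hv)) fun h0 => hxt ?_
    obtain ⟨w, hw⟩ := Finset.card_eq_one.mp
      (by rw [Finset.card_erase_of_mem hv, he2] : ((t.erase c).erase v).card = 1)
    rw [← Finset.add_sum_erase _ _ hv, ← h0, zero_add, hw, Finset.sum_singleton] at hsum
    rw [← Finset.add_sum_erase _ _ hv, ← h0, zero_smul, zero_add, hw, Finset.sum_singleton, hsum,
      one_smul] at hsmul
    have hwm : w ∈ (t.erase c).erase v := hw ▸ Finset.mem_singleton_self w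
    rw [← hsmul]
    exact Finset.mem_of_mem_erase (Finset.mem_of_mem_erase hwm)
  obtain ⟨t', ht', hne, het'⟩ := hedge _ (Finset.erase_subset c t) he2 hxe
  obtain ⟨ht'K, ht'3⟩ := hZ t' ht'
  have ht'i := K.indep ht'K
  obtain ⟨d, hd, hde⟩ := exists_insert_eq het' he2 ht'3
  have hce : c ∉ t.erase c := Finset.notMem_erase c t
  have hci : insert c (t.erase c) = t := Finset.insert_erase hc
  have hcd : c ≠ d := by
    rintro rfl
    exact hne (hde.symm.trans hci)
  have hneg := coord_opposite_neg htK ht'K ht3 ht'3 hce hd hci hde hcd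
  have hprop := coord_eq_mul_coord hti ht'i ht'3 hce hd hci hde
  have hepos' : ∀ v ∈ t.erase c, 0 < coord t' v x := by
    intro v hv
    rw [← hsmul, affineMap_sum_smul _ _ _ hsum, Finset.sum_eq_single v]
    · rw [coord_self ht'i (het' hv), smul_eq_mul, mul_one]
      exact hepos v hv
    · intro u hu huv
      rw [coord_ne ht'i (het' hv) (het' hu) huv.symm, smul_zero]
    · exact fun h => absurd hv h
  have ev : ∀ᶠ y in 𝓝 x, ∀ v ∈ t.erase c, 0 < coord t v y ∧ 0 < coord t' v y :=
    (Filter.eventually_all_finset _).mpr fun v hv =>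
      ((continuous_affine (coord t v)).continuousAt.eventually (lt_mem_nhds (hepos v hv))).and
      ((continuous_affine (coord t' v)).continuousAt.eventually (lt_mem_nhds (hepos' v hv)))
  filter_upwards [ev] with y hy
  -- Near `x` the coordinates at both ends of the edge stay positive in either triangle, so only the
  -- side of the edge matters. The coordinates at `c` and `d` are proportional with a negative
  -- factor, so each side belongs to one triangle.
  rcases le_or_gt 0 (coord t c y) with h | h
  · refine Set.mem_biUnion ht ((mem_convexHull_iff_coord hti ht3 y).mpr fun v hv => ?_)
    rw [← hci, Finset.mem_insert] at hv
    rcases hv with rfl | hv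
    · exact h
    · exact (hy v hv).1.le
  · refine Set.mem_biUnion ht' ((mem_convexHull_iff_coord ht'i ht'3 y).mpr fun v hv => ?_)
    rw [← hde, Finset.mem_insert] at hv
    rcases hv with rfl | hv
    · rw [hprop y] at h
      exact (pos_of_mul_neg_right h hneg.le).le
    · exact (hy v hv).2.le

/-- A preconnected set without vertices that meets a union of triangles is contained in it, if
every edge of these triangles through the set lies in two of them. -/
theorem subset_iUnion_triangles {Z : Set (Finset Plane)} (hfin : Z.Finite)
    (hZ : ∀ t ∈ Z, t ∈ K.faces ∧ t.card = 3) {U : Set Plane} (hU : IsPreconnected U)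
    (hUv : ∀ t ∈ Z, ∀ v ∈ t, v ∉ U)
    (hedge : ∀ t ∈ Z, ∀ e ⊆ t, e.card = 2 → (convexHull ℝ (e : Set Plane) ∩ U).Nonempty →
      ∃ t' ∈ Z, t' ≠ t ∧ e ⊆ t')
    {t : Finset Plane} (ht : t ∈ Z) (hne : (convexHull ℝ (t : Set Plane) ∩ U).Nonempty) :
    U ⊆ ⋃ t ∈ Z, convexHull ℝ (t : Set Plane) := by
  set S : Set Plane := ⋃ t ∈ Z, convexHull ℝ (t : Set Plane) with hS
  have hclosed : IsClosed S := hfin.isClosed_biUnion fun t _ => isClosed_convexHull_finset t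
  -- The closed set `S` is also open relative to `U`, so the connected set `U` cannot leave it.
  have hint : ∀ x ∈ U, x ∈ S → x ∈ interior S := by
    intro x hxU hxS
    obtain ⟨s, hs, hxs⟩ := Set.mem_iUnion₂.mp hxS
    exact mem_interior_iff_mem_nhds.mpr (iUnion_triangles_mem_nhds hZ hs hxs
      (fun h => hUv s hs x h hxU) fun e he he2 hxe => hedge s hs e he he2 ⟨x, hxe, hxU⟩)
  obtain ⟨x, hxt, hxU⟩ := hne
  refine (hU.subset_of_closure_inter_subset isOpen_interior
    ⟨x, hxU, hint x hxU (Set.mem_biUnion ht hxt)⟩ ?_).trans interior_subset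
  rintro y ⟨hy, hyU⟩
  exact hint y hyU (closure_minimal interior_subset hclosed hy)

/-- There is no closed surface in the plane: no finite nonempty set of triangles has all of its
edges in two triangles of the set. -/
theorem not_forall_edge_exists_ne {Z : Set (Finset Plane)} (hfin : Z.Finite)
    (hZ : ∀ t ∈ Z, t ∈ K.faces ∧ t.card = 3) (hne : Z.Nonempty)
    (hedge : ∀ t ∈ Z, ∀ e ⊆ t, e.card = 2 → ∃ t' ∈ Z, t' ≠ t ∧ e ⊆ t') : False := by
  -- The plane minus the finitely many vertices is connected, so the triangles would cover it. But
  -- their union is bounded.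
  set V : Set Plane := ⋃ t ∈ Z, (t : Set Plane) with hV
  have hVfin : V.Finite := hfin.biUnion fun t _ => t.finite_toSet
  have hU : IsPreconnected Vᶜ :=
    (hVfin.countable.isConnected_compl_of_one_lt_rank one_lt_rank_plane).isPreconnected
  obtain ⟨t, ht⟩ := hne
  have htop : (interior (convexHull ℝ (t : Set Plane))).Nonempty := by
    rw [interior_convexHull_nonempty_iff_affineSpan_eq_top]
    have := (K.indep (hZ t ht).1).affineSpan_eq_top_iff_card_eq_finrank_add_one.mpr
      (by simp [(hZ t ht).2])
    simpa using this
  have hmeet : (convexHull ℝ (t : Set Plane) ∩ Vᶜ).Nonempty := by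
    have hd : Dense Vᶜ := hVfin.countable.dense_compl ℝ
    obtain ⟨x, hx, hxV⟩ := hd.inter_open_nonempty _ isOpen_interior htop
    exact ⟨x, interior_subset hx, hxV⟩
  have hsub := subset_iUnion_triangles hfin hZ hU
    (fun t ht v hv h => h (Set.mem_biUnion ht hv)) (fun t ht e he he2 _ => hedge t ht e he he2)
    ht hmeet
  have hb : Bornology.IsBounded (⋃ t ∈ Z, convexHull ℝ (t : Set Plane)) :=
    (hfin.isCompact_biUnion fun t _ => t.finite_toSet.isCompact_convexHull ℝ).isBounded
  refine NormedSpace.unbounded_univ ℝ Plane ((hb.union hVfin.isBounded).subset fun x _ => ?_)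
  by_cases hx : x ∈ V
  · exact Or.inr hx
  · exact Or.inl (hsub hx)

/-! ### Which simplices lie in the frontier -/

/-- The simplices that miss `x` are closed and finite in number, so a small neighbourhood avoids
them all. -/
theorem eventually_mem_convexHull (hfin : K.faces.Finite) (x : Plane) :
    ∀ᶠ y in 𝓝 x, ∀ s ∈ K.faces, y ∈ convexHull ℝ (s : Set Plane) →
      x ∈ convexHull ℝ (s : Set Plane) := by
  refine (Filter.eventually_all_finite hfin).mpr fun s _ => ?_
  by_cases hx : x ∈ convexHull ℝ (s : Set Plane)
  · exact Filter.Eventually.of_forall fun _ _ => hx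
  · filter_upwards [(isClosed_convexHull_finset s).isOpen_compl.mem_nhds hx] with y hy h
    exact absurd h hy

/-- A face containing a relatively interior point of an edge contains the edge. -/
theorem edge_subset_of_mem_convexHull {a b x : Plane} {s : Finset Plane}
    (he : {a, b} ∈ K.faces) (hs : s ∈ K.faces) (hxe : x ∈ convexHull ℝ ({a, b} : Set Plane))
    (hxs : x ∈ convexHull ℝ (s : Set Plane)) (hxa : x ≠ a) (hxb : x ≠ b) :
    ({a, b} : Finset Plane) ⊆ s := by
  have hx := K.inter_subset_convexHull he hs ⟨by simpa using hxe, hxs⟩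
  have key : ∀ u v : Plane, ({a, b} : Set Plane) ⊆ {u, v} → x ≠ v → u ∈ s := by
    intro u v huv hxv
    by_contra hu
    have hsub : ((({a, b} : Finset Plane) : Set Plane) ∩ s) ⊆ {v} := by
      rintro w ⟨hw, hws⟩
      rcases huv (by simpa using hw) with rfl | h
      · exact absurd hws hu
      · exact h
    have := convexHull_mono hsub hx
    rw [convexHull_singleton] at this
    exact hxv this
  intro w hw
  rw [Finset.mem_insert, Finset.mem_singleton] at hw
  rcases hw with rfl | rfl
  · exact key w b subset_rfl hxb
  · exact key w a (Set.pair_comm a w).subset hxa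

theorem card_le_three {s : Finset Plane} (hs : s ∈ K.faces) : s.card ≤ 3 := by
  have := (K.indep hs).card_le_finrank_succ
  have h2 := Submodule.finrank_le (vectorSpan ℝ (Set.range ((↑) : s → Plane)))
  simp at this h2
  omega

/-- An edge contained in a single triangle lies in the frontier. -/
theorem edge_subset_frontier (hfin : K.faces.Finite) {e t : Finset Plane} (he : e ∈ K.faces)
    (he2 : e.card = 2) (ht : t ∈ K.faces) (ht3 : t.card = 3) (het : e ⊆ t)
    (huniq : ∀ t' ∈ K.faces, t'.card = 3 → e ⊆ t' → t' = t) :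
    convexHull ℝ (e : Set Plane) ⊆ frontier K.space := by
  classical
  obtain ⟨c, hc, hce⟩ := exists_insert_eq het he2 ht3
  have hti := K.indep ht
  have hct : c ∈ t := hce ▸ Finset.mem_insert_self _ _
  obtain ⟨a, b, hab, rfl⟩ := Finset.card_eq_two.mp he2
  have hcoord : ∀ v ∈ ({a, b} : Finset Plane), coord t c v = 0 := fun v hv =>
    coord_ne hti hct (het hv) fun h => hc (h ▸ hv)
  rw [Finset.coe_pair, convexHull_pair, ← closure_openSegment]
  refine closure_minimal (fun x hx => ?_) isClosed_frontier
  have hxe : x ∈ convexHull ℝ ({a, b} : Set Plane) := by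
    rw [convexHull_pair]
    exact openSegment_subset_segment ℝ a b hx
  have hxa : x ≠ a := by
    rintro rfl
    exact hab (left_mem_openSegment_iff.mp hx)
  have hxb : x ≠ b := by
    rintro rfl
    exact hab (right_mem_openSegment_iff.mp hx)
  have hxsp : x ∈ K.space := Geometry.SimplicialComplex.convexHull_subset_space he (by simpa using hxe)
  refine ⟨subset_closure hxsp, fun hint => ?_⟩
  have hcx : coord t c x = 0 := affineMap_eq_zero_of_mem_convexHull
    (s := ({a, b} : Set Plane)) (fun v hv => hcoord v (by simpa using hv)) hxe
  have hcont : Continuous fun ε : ℝ => (AffineMap.lineMap x c ε : Plane) :=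
    AffineMap.lineMap_continuous
  have hnear := (eventually_mem_convexHull hfin x).and (mem_interior_iff_mem_nhds.mp hint)
  have h0 : (AffineMap.lineMap x c (0 : ℝ) : Plane) = x := AffineMap.lineMap_apply_zero _ _
  rw [← h0] at hnear
  -- A negative parameter moves `x` away from `c`, across the edge. Any simplex met there also
  -- contains `x`, hence the whole edge, hence is a face of `t`; but the coordinate at `c` is
  -- negative there.
  have hev : ∀ᶠ ε in 𝓝[<] (0 : ℝ), (∀ s ∈ K.faces,
      AffineMap.lineMap x c ε ∈ convexHull ℝ (s : Set Plane) →
        AffineMap.lineMap x c (0 : ℝ) ∈ convexHull ℝ (s : Set Plane)) ∧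
      AffineMap.lineMap x c ε ∈ K.space :=
    nhdsWithin_le_nhds (hcont.continuousAt.eventually hnear)
  obtain ⟨ε, ⟨hε, hεsp⟩, hεneg⟩ := (hev.and self_mem_nhdsWithin).exists
  rw [h0] at hε
  have hcy : coord t c (AffineMap.lineMap x c ε) = ε := by
    rw [AffineMap.apply_lineMap, hcx, coord_self hti hct, AffineMap.lineMap_apply]
    simp
  obtain ⟨s, hs, hys⟩ := Geometry.SimplicialComplex.mem_space_iff.mp hεsp
  have hes := edge_subset_of_mem_convexHull he hs hxe (hε s hs hys) hxa hxb
  have hst : s ⊆ t := by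
    have h2 := Finset.card_le_card hes
    rw [he2] at h2
    have h3 := card_le_three hs
    rcases (by omega : s.card = 2 ∨ s.card = 3) with h | h
    · rw [← Finset.eq_of_subset_of_card_le hes (by omega)]
      exact het
    · exact (huniq s hs h hes).subset
  have := (mem_convexHull_iff_coord hti ht3 _).mp
    (convexHull_mono (Finset.coe_subset.mpr hst) hys) c hct
  rw [hcy] at this
  exact absurd this (not_le.mpr hεneg)

/-- An edge contained in two triangles does not lie in the frontier. -/
theorem not_edge_subset_frontier {e t₁ t₂ : Finset Plane} (he2 : e.card = 2)
    (ht₁ : t₁ ∈ K.faces) (ht₂ : t₂ ∈ K.faces) (h₁3 : t₁.card = 3) (h₂3 : t₂.card = 3)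
    (h₁ : e ⊆ t₁) (h₂ : e ⊆ t₂) (hne : t₁ ≠ t₂) :
    ¬ convexHull ℝ (e : Set Plane) ⊆ frontier K.space := by
  classical
  obtain ⟨a, b, hab, rfl⟩ := Finset.card_eq_two.mp he2
  set m := midpoint ℝ a b with hm
  have hme : m ∈ convexHull ℝ ((({a, b} : Finset Plane)) : Set Plane) := by
    rw [Finset.coe_pair, convexHull_pair]
    exact midpoint_mem_segment a b
  have hma : m ≠ a := fun h => hab ((midpoint_eq_left_iff ℝ).mp h)
  have hmb : m ≠ b := fun h => hab ((midpoint_eq_right_iff ℝ).mp h)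
  have heK : ({a, b} : Finset Plane) ∈ K.faces := K.down_closed ht₁ h₁ (by simp)
  have hZ : ∀ t ∈ ({t₁, t₂} : Set (Finset Plane)), t ∈ K.faces ∧ t.card = 3 := by
    rintro t (rfl | rfl)
    exacts [⟨ht₁, h₁3⟩, ⟨ht₂, h₂3⟩]
  -- The midpoint is interior to the union of the two triangles: it is not a vertex, and no other
  -- edge passes through it.
  have hnhds := iUnion_triangles_mem_nhds hZ (Set.mem_insert t₁ _)
    (convexHull_mono (Finset.coe_subset.mpr h₁) hme) (x := m) ?_ ?_
  · intro hsub
    refine (hsub hme).2 (mem_interior_iff_mem_nhds.mpr (Filter.mem_of_superset hnhds ?_))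
    exact Set.iUnion₂_subset fun t ht =>
      Geometry.SimplicialComplex.convexHull_subset_space (hZ t ht).1
  · intro hmt
    have hmK : {m} ∈ K.faces := K.down_closed ht₁ (by simpa using hmt) (by simp)
    have := edge_subset_of_mem_convexHull heK hmK (by simpa using hme) (by simp) hma hmb
    have ha : a ∈ ({m} : Finset Plane) := this (by simp)
    exact hma (Finset.mem_singleton.mp ha).symm
  · intro e' he' he'2 hme'
    have he'K : e' ∈ K.faces :=
      K.down_closed ht₁ he' (Finset.card_pos.mp (by omega))
    have hsub := edge_subset_of_mem_convexHull heK he'K (by simpa using hme) hme' hma hmb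
    have : ({a, b} : Finset Plane) = e' := Finset.eq_of_subset_of_card_le hsub (by omega)
    exact ⟨t₂, by simp, hne.symm, this ▸ h₂⟩

/-- A triangle does not lie in the frontier. -/
theorem not_triangle_subset_frontier {t : Finset Plane} (ht : t ∈ K.faces) (ht3 : t.card = 3) :
    ¬ convexHull ℝ (t : Set Plane) ⊆ frontier K.space := by
  intro hsub
  have htop : (interior (convexHull ℝ (t : Set Plane))).Nonempty := by
    rw [interior_convexHull_nonempty_iff_affineSpan_eq_top]
    have := (K.indep ht).affineSpan_eq_top_iff_card_eq_finrank_add_one.mpr (by simp [ht3])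
    simpa using this
  obtain ⟨x, hx⟩ := htop
  exact (hsub (interior_subset hx)).2
    (interior_mono (Geometry.SimplicialComplex.convexHull_subset_space ht) hx)

/-- A vertex of a triangle is interior if all triangles at it have neighbours across all edges
at it. -/
theorem vertex_mem_interior (hfin : K.faces.Finite) {v : Plane} {t₀ : Finset Plane}
    (ht₀ : t₀ ∈ K.faces) (h₀3 : t₀.card = 3) (hv : v ∈ t₀)
    (hedge : ∀ t ∈ K.faces, t.card = 3 → ∀ e ⊆ t, e.card = 2 → v ∈ e →
      ∃ t' ∈ K.faces, t'.card = 3 ∧ t' ≠ t ∧ e ⊆ t') : v ∈ interior K.space := by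
  have hvK : v ∈ K.vertices := K.down_closed ht₀ (by simpa using hv) (by simp)
  obtain ⟨r, hr, hball⟩ := Metric.eventually_nhds_iff_ball.mp (eventually_mem_convexHull hfin v)
  have hmem : ∀ y ∈ Metric.ball v r, ∀ s ∈ K.faces, y ∈ convexHull ℝ (s : Set Plane) → v ∈ s :=
    fun y hy s hs hys =>
      (Geometry.SimplicialComplex.vertex_mem_convexHull_iff hvK hs).mp (hball y hy s hs hys)
  let Z : Set (Finset Plane) := {t | t ∈ K.faces ∧ t.card = 3 ∧ v ∈ t}
  have hZ : ∀ t ∈ Z, t ∈ K.faces ∧ t.card = 3 := fun t ht => ⟨ht.1, ht.2.1⟩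
  -- In this ball only simplices containing `v` occur. The punctured ball is connected and contains
  -- no vertices, so it is filled by the triangles at `v` as soon as it meets one of them.
  have hsub : Metric.ball v r \ {v} ⊆ ⋃ t ∈ Z, convexHull ℝ (t : Set Plane) := by
    refine subset_iUnion_triangles (hfin.subset fun t ht => ht.1) hZ
      (isPreconnected_ball_diff v hr (Set.countable_singleton v)) ?_ ?_ (t := t₀)
      ⟨ht₀, h₀3, hv⟩ ?_
    · rintro t ht w hw ⟨hwb, hwv⟩
      have hwK : {w} ∈ K.faces := K.down_closed ht.1 (by simpa using hw) (by simp)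
      have := hmem w hwb {w} hwK (by simp)
      exact hwv (Finset.mem_singleton.mp this).symm
    · rintro t ht e het he2 ⟨y, hye, hyb, -⟩
      have heK : e ∈ K.faces := K.down_closed ht.1 het (Finset.card_pos.mp (by omega))
      have hve := hmem y hyb e heK hye
      obtain ⟨t', ht', ht'3, hne, het'⟩ := hedge t ht.1 ht.2.1 e het he2 hve
      exact ⟨t', ⟨ht', ht'3, het' hve⟩, hne, het'⟩
    · obtain ⟨w, hw, hwv⟩ := Finset.exists_mem_ne (by omega : 1 < t₀.card) v
      have hcont : Continuous fun ε : ℝ => (AffineMap.lineMap v w ε : Plane) :=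
        AffineMap.lineMap_continuous
      have h0 : (AffineMap.lineMap v w (0 : ℝ) : Plane) = v := AffineMap.lineMap_apply_zero _ _
      have hn : Metric.ball v r ∈ 𝓝 (AffineMap.lineMap v w (0 : ℝ) : Plane) := by
        rw [h0]
        exact Metric.ball_mem_nhds v hr
      have hev : ∀ᶠ ε in 𝓝[>] (0 : ℝ), AffineMap.lineMap v w ε ∈ Metric.ball v r :=
        nhdsWithin_le_nhds (hcont.continuousAt.eventually hn)
      have hlt1 : ∀ᶠ ε in 𝓝[>] (0 : ℝ), ε < 1 := nhdsWithin_le_nhds (gt_mem_nhds one_pos)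
      obtain ⟨ε, ⟨hε, hε1⟩, hε0⟩ := ((hev.and hlt1).and self_mem_nhdsWithin).exists
      have hε0' : (0 : ℝ) < ε := hε0
      refine ⟨AffineMap.lineMap v w ε, ?_, hε, ?_⟩
      · exact (convex_convexHull ℝ _).lineMap_mem (subset_convexHull _ _ hv)
          (subset_convexHull _ _ hw) ⟨hε0'.le, hε1.le⟩
      · intro h
        rw [Set.mem_singleton_iff, AffineMap.lineMap_eq_left_iff] at h
        exact h.elim (fun h => hwv h.symm) hε0'.ne'
  refine mem_interior.mpr ⟨Metric.ball v r, fun x hx => ?_, Metric.isOpen_ball,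
    Metric.mem_ball_self hr⟩
  by_cases hxv : x = v
  · rw [hxv]
    exact Geometry.SimplicialComplex.vertices_subset_space hvK
  · obtain ⟨t, ht, hxt⟩ := Set.mem_iUnion₂.mp (hsub ⟨hx, hxv⟩)
    exact Geometry.SimplicialComplex.convexHull_subset_space ht.1 hxt

/-! ### Vertex functions and one-cocycles -/

/-- A function on vertices that agrees along edges avoiding `p` is constant on the vertices other
than `p`, if the complex minus `p` is connected. -/
theorem eq_of_isPreconnected_diff_singleton {α : Type*} (hfin : K.faces.Finite) {p : Plane}
    (hconn : IsPreconnected (K.space \ {p})) (g : Plane → α)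
    (hg : ∀ s ∈ K.faces, ∀ a ∈ s, ∀ b ∈ s, a ≠ p → b ≠ p → g a = g b) {a b : Plane}
    (ha : {a} ∈ K.faces) (hb : {b} ∈ K.faces) (hap : a ≠ p) (hbp : b ≠ p) : g a = g b := by
  by_contra hne
  let A : Set (Finset Plane) := {s | s ∈ K.faces ∧ ∃ w ∈ s, w ≠ p ∧ g w = g a}
  let B : Set (Finset Plane) := {s | s ∈ K.faces ∧ ∃ w ∈ s, w ≠ p ∧ g w ≠ g a}
  have hclosed : ∀ C : Set (Finset Plane), C ⊆ K.faces →
      IsClosed (⋃ s ∈ C, convexHull ℝ (s : Set Plane)) := fun C hC =>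
    (hfin.subset hC).isClosed_biUnion fun t _ => isClosed_convexHull_finset t
  have hexists : ∀ (s : Set Plane) (x : Plane), x ∈ convexHull ℝ s → x ≠ p → ∃ w ∈ s, w ≠ p := by
    intro s x hx hxp
    by_contra! h
    have : x ∈ convexHull ℝ {p} := convexHull_mono (fun w hw => h w hw) hx
    rw [convexHull_singleton] at this
    exact hxp this
  -- `A` and `B` would give closed sets covering the connected punctured space, so they meet away
  -- from `p`. The two simplices through a meeting point share a vertex other than `p`, at which the
  -- values of `g` collide.
  obtain ⟨x, ⟨-, hxp⟩, hxA, hxB⟩ := isPreconnected_closed_iff.mp hconn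
    (⋃ s ∈ A, convexHull ℝ (s : Set Plane)) (⋃ s ∈ B, convexHull ℝ (s : Set Plane))
    (hclosed A fun s hs => hs.1) (hclosed B fun s hs => hs.1)
    (by
      rintro x ⟨hx, hxp⟩
      obtain ⟨s, hs, hxs⟩ := Geometry.SimplicialComplex.mem_space_iff.mp hx
      obtain ⟨w, hw, hwp⟩ := hexists _ x hxs hxp
      by_cases h : g w = g a
      · exact Or.inl (Set.mem_biUnion (show s ∈ A from ⟨hs, w, hw, hwp, h⟩) hxs)
      · exact Or.inr (Set.mem_biUnion (show s ∈ B from ⟨hs, w, hw, hwp, h⟩) hxs))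
    ⟨a, ⟨Geometry.SimplicialComplex.vertices_subset_space ha, hap⟩,
      Set.mem_biUnion (show {a} ∈ A from ⟨ha, a, by simp, hap, rfl⟩) (by simp)⟩
    ⟨b, ⟨Geometry.SimplicialComplex.vertices_subset_space hb, hbp⟩,
      Set.mem_biUnion (show {b} ∈ B from ⟨hb, b, by simp, hbp, Ne.symm hne⟩) (by simp)⟩
  obtain ⟨s, ⟨hs, u, hu, hup, hgu⟩, hxs⟩ := Set.mem_iUnion₂.mp hxA
  obtain ⟨t, ⟨ht, v, hv, hvp, hgv⟩, hxt⟩ := Set.mem_iUnion₂.mp hxB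
  obtain ⟨w, ⟨hws, hwt⟩, hwp⟩ := hexists _ x (K.inter_subset_convexHull hs ht ⟨hxs, hxt⟩) hxp
  exact hgv ((hg t ht v hv w hwt hvp hwp).trans ((hg s hs w hws u hu hwp hup).trans hgu))

theorem exists_affineMap_extend {s : Finset Plane} (hs : AffineIndependent ℝ ((↑) : s → Plane))
    (r : Plane → ℝ) : ∃ F : Plane →ᵃ[ℝ] ℝ, ∀ w ∈ s, F w = r w := by
  have key : ∀ u : Finset Plane, ∃ F : Plane →ᵃ[ℝ] ℝ, ∀ x, F x = ∑ v ∈ u, r v * coord s v x := by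
    classical
    intro u
    induction u using Finset.induction_on with
    | empty => exact ⟨AffineMap.const ℝ Plane 0, fun x => by simp⟩
    | insert v u hv ih =>
      obtain ⟨F, hF⟩ := ih
      refine ⟨r v • coord s v + F, fun x => ?_⟩
      rw [Finset.sum_insert hv, ← hF]
      rfl
  obtain ⟨F, hF⟩ := key s
  refine ⟨F, fun w hw => ?_⟩
  rw [hF, Finset.sum_eq_single w]
  · rw [coord_self hs hw, mul_one]
  · intro v hv hvw
    rw [coord_ne hs hv hw hvw, mul_zero]
  · exact fun h => absurd hw h

theorem eq_of_continuous_of_forall_int {X : Type*} [TopologicalSpace X] [PreconnectedSpace X]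
    {ψ : X → ℝ} (hψ : Continuous ψ) (h : ∀ x, ∃ n : ℤ, ψ x = n) (x y : X) : ψ x = ψ y := by
  choose n hn using h
  have hn' : ((↑) : ℤ → ℝ) ∘ n = ψ := funext fun x => (hn x).symm
  have hcont : Continuous n := by
    rw [Int.isClosedEmbedding_coe_real.isEmbedding.continuous_iff, hn']
    exact hψ
  rw [hn, hn, PreconnectedSpace.constant inferInstance hcont]

/-- If all maps from a complex to the circle lift to the line, then its integral simplicial
one-cocycles are coboundaries. -/
theorem exists_int_potential (hfin : K.faces.Finite)
    (hlift : ∀ f : C(K.space, AddCircle (1 : ℝ)),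
      ∃ G : C(K.space, ℝ), ∀ x, ((G x : ℝ) : AddCircle (1 : ℝ)) = f x)
    (c : Plane → Plane → ℤ)
    (hc : ∀ s ∈ K.faces, ∀ a ∈ s, ∀ b ∈ s, ∀ d ∈ s, c a b + c b d = c a d) :
    ∃ g : Plane → ℤ, ∀ s ∈ K.faces, ∀ a ∈ s, ∀ b ∈ s, c a b = g b - g a := by
  -- On each simplex, `c` is interpolated affinely from a base vertex `β`. Two interpolations differ
  -- on an overlap by an integer constant, so together they define a map to the circle. Its lift to
  -- the line is the potential.
  have hex : ∀ s ∈ K.faces, ∃ F : Plane →ᵃ[ℝ] ℝ, ∃ β ∈ s, ∀ w ∈ s, F w = c β w := by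
    intro s hs
    obtain ⟨β, hβ⟩ := K.nonempty_of_mem_faces hs
    obtain ⟨F, hF⟩ := exists_affineMap_extend (K.indep hs) fun w => (c β w : ℝ)
    exact ⟨F, β, hβ, hF⟩
  choose! F β hβ hF using hex
  have hcompat : ∀ s ∈ K.faces, ∀ t ∈ K.faces, ∀ x ∈ convexHull ℝ (s : Set Plane),
      x ∈ convexHull ℝ (t : Set Plane) →
      ((F s x : ℝ) : AddCircle (1 : ℝ)) = ((F t x : ℝ) : AddCircle (1 : ℝ)) := by
    intro s hs t ht x hxs hxt
    have hx := K.inter_subset_convexHull hs ht ⟨hxs, hxt⟩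
    obtain ⟨w₀, hw₀s, hw₀t⟩ := convexHull_nonempty_iff.mp ⟨x, hx⟩
    have h0 := affineMap_eq_zero_of_mem_convexHull
      (φ := F s - F t - AffineMap.const ℝ Plane ((c (β s) w₀ - c (β t) w₀ : ℤ) : ℝ)) ?_ hx
    · rw [← sub_eq_zero, ← AddCircle.coe_sub, AddCircle.coe_eq_zero_iff]
      refine ⟨c (β s) w₀ - c (β t) w₀, ?_⟩
      have h1 : F s x - F t x - ((c (β s) w₀ - c (β t) w₀ : ℤ) : ℝ) = 0 := h0
      rw [zsmul_eq_mul, mul_one]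
      linarith
    · rintro w ⟨hws, hwt⟩
      change F s w - F t w - ((c (β s) w₀ - c (β t) w₀ : ℤ) : ℝ) = 0
      rw [hF s hs w hws, hF t ht w hwt, ← hc s hs _ (hβ s hs) w₀ hw₀s w hws,
        ← hc t ht _ (hβ t ht) w₀ hw₀t w hwt]
      push_cast
      ring
  classical
  let f : Plane → AddCircle (1 : ℝ) := fun x =>
    if h : ∃ s, s ∈ K.faces ∧ x ∈ convexHull ℝ (s : Set Plane) then ((F h.choose x : ℝ) : _) else 0
  have hf : ∀ s ∈ K.faces, ∀ x ∈ convexHull ℝ (s : Set Plane),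
      f x = ((F s x : ℝ) : AddCircle (1 : ℝ)) := by
    intro s hs x hx
    have h : ∃ s, s ∈ K.faces ∧ x ∈ convexHull ℝ (s : Set Plane) := ⟨s, hs, hx⟩
    simp only [f, dif_pos h]
    exact hcompat _ h.choose_spec.1 s hs x h.choose_spec.2 hx
  have hcont : ContinuousOn f K.space := by
    have : Finite K.faces := hfin
    have hsp : K.space = ⋃ s : K.faces, convexHull ℝ ((s : Finset Plane) : Set Plane) :=
      Set.biUnion_eq_iUnion _ _
    rw [hsp]
    refine (locallyFinite_of_finite _).continuousOn_iUnion
      (fun s => isClosed_convexHull_finset _) fun s => ?_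
    have hc' : Continuous fun x => ((F s x : ℝ) : AddCircle (1 : ℝ)) :=
      (AddCircle.isCoveringMap_coe (1 : ℝ)).continuous.comp (continuous_affine (F s))
    exact hc'.continuousOn.congr fun x hx => hf s s.2 x hx
  obtain ⟨G, hG⟩ := hlift ⟨fun x => f x, continuousOn_iff_continuous_domRestrict.mp hcont⟩
  have hmem : ∀ s ∈ K.faces, ∀ x ∈ convexHull ℝ (s : Set Plane), x ∈ K.space :=
    fun s hs x hx => Geometry.SimplicialComplex.convexHull_subset_space hs hx
  let G' : Plane → ℝ := fun x => if h : x ∈ K.space then G ⟨x, h⟩ else 0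
  have hG' : ∀ x (hx : x ∈ K.space), G' x = G ⟨x, hx⟩ := fun x hx => dif_pos hx
  have hint : ∀ s ∈ K.faces, ∀ x ∈ convexHull ℝ (s : Set Plane), ∃ n : ℤ, G' x - F s x = n := by
    intro s hs x hx
    have h1 := hG ⟨x, hmem s hs x hx⟩
    change _ = f x at h1
    rw [hf s hs x hx, ← sub_eq_zero, ← AddCircle.coe_sub, AddCircle.coe_eq_zero_iff] at h1
    obtain ⟨n, hn⟩ := h1
    refine ⟨n, ?_⟩
    rw [hG' x (hmem s hs x hx), ← hn, zsmul_eq_mul, mul_one]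
  have hconst : ∀ s ∈ K.faces, ∀ a ∈ s, ∀ b ∈ s, G' a - F s a = G' b - F s b := by
    intro s hs a ha b hb
    have : PreconnectedSpace (convexHull ℝ (s : Set Plane)) :=
      Subtype.preconnectedSpace (convex_convexHull ℝ _).isPreconnected
    have hcG : Continuous fun x : convexHull ℝ (s : Set Plane) => G' x - F s x := by
      have h2 : (fun x : convexHull ℝ (s : Set Plane) => G' x) =
          fun x : convexHull ℝ (s : Set Plane) => G ⟨x, hmem s hs x x.2⟩ :=
        funext fun x => hG' x (hmem s hs x x.2)
      refine Continuous.sub ?_ ((continuous_affine (F s)).comp continuous_subtype_val)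
      rw [h2]
      exact G.continuous.comp (continuous_subtype_val.subtype_mk _)
    exact eq_of_continuous_of_forall_int hcG (fun x => hint s hs x x.2)
      ⟨a, subset_convexHull _ _ ha⟩ ⟨b, subset_convexHull _ _ hb⟩
  -- The lift is already an integer at every vertex; the floor merely reads it as an element of `ℤ`.
  have hfloor : ∀ s ∈ K.faces, ∀ a ∈ s, ((⌊G' a⌋ : ℤ) : ℝ) = G' a := by
    intro s hs a ha
    obtain ⟨n, hn⟩ := hint s hs a (subset_convexHull _ _ ha)
    rw [hF s hs a ha] at hn
    have : G' a = ((n + c (β s) a : ℤ) : ℝ) := by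
      push_cast
      linarith
    rw [this, Int.floor_intCast]
  refine ⟨fun x => ⌊G' x⌋, fun s hs a ha b hb => ?_⟩
  have h1 := hconst s hs a ha b hb
  have h2 : ((c (β s) a + c a b : ℤ) : ℝ) = (c (β s) b : ℤ) := by
    rw [hc s hs _ (hβ s hs) a ha b hb]
  have h3 : ((c a b : ℤ) : ℝ) = ((⌊G' b⌋ - ⌊G' a⌋ : ℤ) : ℝ) := by
    rw [Int.cast_sub, hfloor s hs a ha, hfloor s hs b hb]
    rw [hF s hs a ha, hF s hs b hb] at h1
    push_cast at h2
    linarith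
  exact_mod_cast h3

/-- If all maps from a complex to the circle lift to the line, then its rational simplicial
one-cocycles are coboundaries. -/
theorem exists_potential (hfin : K.faces.Finite)
    (hlift : ∀ f : C(K.space, AddCircle (1 : ℝ)),
      ∃ G : C(K.space, ℝ), ∀ x, ((G x : ℝ) : AddCircle (1 : ℝ)) = f x)
    (c : Plane → Plane → ℚ)
    (hc : ∀ s ∈ K.faces, ∀ a ∈ s, ∀ b ∈ s, ∀ d ∈ s, c a b + c b d = c a d) :
    ∃ g : Plane → ℚ, ∀ s ∈ K.faces, ∀ a ∈ s, ∀ b ∈ s, c a b = g b - g a := by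
  classical
  let V : Finset Plane := hfin.toFinset.biUnion id
  have hV : ∀ s ∈ K.faces, ∀ a ∈ s, a ∈ V := fun s hs a ha =>
    Finset.mem_biUnion.mpr ⟨s, hfin.mem_toFinset.mpr hs, ha⟩
  -- A common denominator of the finitely many relevant values reduces to the integral case.
  obtain ⟨N, hN⟩ := IsLocalization.exist_integer_multiples_of_finset (nonZeroDivisors ℤ)
    ((V ×ˢ V).image fun q => c q.1 q.2)
  have hN0 : ((N : ℤ) : ℚ) ≠ 0 := Int.cast_ne_zero.mpr (nonZeroDivisors.ne_zero N.2)
  have hz : ∀ a b, ∃ z : ℤ, a ∈ V → b ∈ V → (z : ℚ) = (N : ℤ) * c a b := by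
    intro a b
    by_cases h : a ∈ V ∧ b ∈ V
    · obtain ⟨z, hz⟩ := hN (c a b) (Finset.mem_image.mpr ⟨(a, b), by simp [h.1, h.2], rfl⟩)
      refine ⟨z, fun _ _ => ?_⟩
      rw [zsmul_eq_mul] at hz
      exact hz
    · exact ⟨0, fun ha hb => absurd ⟨ha, hb⟩ h⟩
  choose z hz using hz
  obtain ⟨g, hg⟩ := exists_int_potential hfin hlift z (by
    intro s hs a ha b hb d hd
    have h : ((z a b + z b d : ℤ) : ℚ) = (z a d : ℤ) := by
      rw [Int.cast_add, hz a b (hV s hs a ha) (hV s hs b hb),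
        hz b d (hV s hs b hb) (hV s hs d hd), hz a d (hV s hs a ha) (hV s hs d hd),
        ← hc s hs a ha b hb d hd]
      ring
    exact_mod_cast h)
  refine ⟨fun x => g x / (N : ℤ), fun s hs a ha b hb => ?_⟩
  have h1 := hz a b (hV s hs a ha) (hV s hs b hb)
  rw [hg s hs a ha b hb] at h1
  push_cast at h1
  rw [← sub_div, h1, mul_div_cancel_left₀ _ hN0]

/-- The link of a vertex `v` is connected if `v` does not disconnect the complex and the first
cohomology vanishes. -/
theorem link_connected (hfin : K.faces.Finite)
    (hlift : ∀ f : C(K.space, AddCircle (1 : ℝ)),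
      ∃ G : C(K.space, ℝ), ∀ x, ((G x : ℝ) : AddCircle (1 : ℝ)) = f x)
    {v : Plane} (hconn : IsPreconnected (K.space \ {v})) (f : Plane → ℚ)
    (hf : ∀ s ∈ K.faces, v ∈ s → ∀ a ∈ s, ∀ b ∈ s, a ≠ v → b ≠ v → f a = f b) {a b : Plane}
    (ha : {v, a} ∈ K.faces) (hb : {v, b} ∈ K.faces) (hav : a ≠ v) (hbv : b ≠ v) : f a = f b := by
  classical
  -- The function `f` on the link is turned into a cocycle supported on the edges at `v`. Its
  -- potential `g` is constant along every edge avoiding `v`, hence constant off `v`, while `f` is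
  -- the difference of `g` and `g v` on the link.
  obtain ⟨g, hg⟩ := exists_potential hfin hlift
    (fun x y => if x = v then (if y = v then 0 else f y) else if y = v then - f x else 0) (by
      intro s hs a ha b hb d hd
      by_cases hv : v ∈ s
      · have := hf s hs hv
        by_cases h1 : a = v <;> by_cases h2 : b = v <;> by_cases h3 : d = v <;>
          simp only [h1, h2, h3, if_true, if_false, add_zero, zero_add,
            add_neg_cancel]
        · exact this b hb d hd h2 h3
        · rw [this a ha d hd h1 h3, neg_add_cancel]
        · rw [this a ha b hb h1 h2]
      · have h : ∀ x ∈ s, x ≠ v := fun x hx hxv => hv (hxv ▸ hx)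
        simp [h a ha, h b hb, h d hd])
  have hgc : g a = g b := by
    refine eq_of_isPreconnected_diff_singleton hfin hconn g ?_
      (K.down_closed ha (by simp) (by simp)) (K.down_closed hb (by simp) (by simp)) hav hbv
    intro s hs x hx y hy hxv hyv
    have := hg s hs x hx y hy
    simp only [hxv, hyv, if_false] at this
    linarith
  have h1 := hg _ ha v (by simp) a (by simp)
  have h2 := hg _ hb v (by simp) b (by simp)
  simp only [if_true, hav, hbv, if_false] at h1 h2
  rw [h1, h2, hgc]

/-! ### Disk-like complexes -/

/-- The properties of triangulated disks in the plane which determine their Euler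
characteristic. -/
structure IsDiskLike (K : Geometry.SimplicialComplex ℝ Plane) : Prop where
  finite : K.faces.Finite
  conn : ∀ p, IsPreconnected (K.space \ {p})
  lift : ∀ f : C(K.space, AddCircle (1 : ℝ)),
    ∃ G : C(K.space, ℝ), ∀ x, ((G x : ℝ) : AddCircle (1 : ℝ)) = f x
  nontrivial : K.space.Nontrivial

theorem IsDiskLike.of_homeomorph (hfin : K.faces.Finite)
    (h : K.space ≃ₜ Metric.closedBall (0 : Plane) 1) : IsDiskLike K :=
  ⟨hfin, isPreconnected_diff_singleton_of_homeomorph h, exists_lift_of_homeomorph h,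
    nontrivial_of_homeomorph h⟩

/-- Puncturing at any point other than `a` and `b` is harmless, so `conn` also supplies plain
connectedness. -/
theorem IsDiskLike.eq_of_forall_faces (hK : IsDiskLike K) {α : Type*} (g : Plane → α)
    (hg : ∀ s ∈ K.faces, ∀ a ∈ s, ∀ b ∈ s, g a = g b) {a b : Plane}
    (ha : {a} ∈ K.faces) (hb : {b} ∈ K.faces) : g a = g b := by
  classical
  obtain ⟨p, hp⟩ := Infinite.exists_notMem_finset ({a, b} : Finset Plane)
  simp only [Finset.mem_insert, Finset.mem_singleton, not_or] at hp
  exact eq_of_isPreconnected_diff_singleton hK.finite (hK.conn p) g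
    (fun s hs x hx y hy _ _ => hg s hs x hx y hy) ha hb (Ne.symm hp.1) (Ne.symm hp.2)

theorem space_subset_convexHull {V : Set Plane} (hV : ∀ v, {v} ∈ K.faces → v ∈ V) :
    K.space ⊆ convexHull ℝ V := by
  intro x hx
  obtain ⟨s, hs, hxs⟩ := Geometry.SimplicialComplex.mem_space_iff.mp hx
  exact convexHull_mono (fun w hw => hV w (K.down_closed hs (by simpa using hw) (by simp))) hxs

/-- An isolated vertex would, by connectedness, be the whole complex, whose space has more than one
point. -/
theorem IsDiskLike.exists_edge (hK : IsDiskLike K) {v : Plane} (hv : {v} ∈ K.faces) :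
    ∃ a, a ≠ v ∧ {v, a} ∈ K.faces := by
  classical
  by_contra! h
  have hall : ∀ w, {w} ∈ K.faces → w ∈ ({v} : Set Plane) := by
    intro w hw
    have hg := hK.eq_of_forall_faces (fun x => x = v) ?_ hv hw
    · simpa using hg
    · intro s hs x hx y hy
      by_contra hne
      have key : ∀ x ∈ s, ∀ y ∈ s, x = v → y = v := by
        intro x hx y hy hxv
        by_contra hyv
        refine h y hyv (K.down_closed hs ?_ (by simp))
        rw [Finset.insert_subset_iff, Finset.singleton_subset_iff]
        exact ⟨hxv ▸ hx, hy⟩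
      exact hne (propext ⟨key x hx y hy, key y hy x hx⟩)
  have hsub := space_subset_convexHull hall
  rw [convexHull_singleton] at hsub
  exact hK.nontrivial.not_subset_singleton hsub

/-- Every edge of a triangulated disk lies in a triangle. -/
theorem IsDiskLike.exists_triangle (hK : IsDiskLike K) {e : Finset Plane} (he : e ∈ K.faces)
    (he2 : e.card = 2) : ∃ t ∈ K.faces, t.card = 3 ∧ e ⊆ t := by
  classical
  by_contra! h
  -- With no triangle on the edge, `b` is isolated in the link of `a`, so the indicator of `b` is
  -- locally constant there. Connectedness of the link leaves `b` as the only neighbour of `a`.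
  have hlink : ∀ a b : Plane, a ≠ b → e = {a, b} → ∀ y, {a, y} ∈ K.faces → y ≠ a → y = b := by
    intro a b hab heq y hy hya
    have hf := link_connected hK.finite hK.lift (hK.conn a)
      (fun x => if x = b then (1 : ℚ) else 0) ?_ (heq ▸ he) hy hab.symm hya
    · by_contra hyb
      simp [hyb] at hf
    · intro s hs has u hu w hw hua hwa
      have key : ∀ u ∈ s, ∀ w ∈ s, w ≠ a → u = b → w = b := by
        intro u hu w hw hwa hub
        by_contra hwb
        have hsub : ({w, a, b} : Finset Plane) ⊆ s := by
          simp only [Finset.insert_subset_iff, Finset.singleton_subset_iff]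
          exact ⟨hw, has, hub ▸ hu⟩
        refine h {w, a, b} (K.down_closed hs hsub (by simp)) ?_ ?_
        · exact Finset.card_eq_three.mpr ⟨w, a, b, hwa, hwb, hab, rfl⟩
        · rw [heq]
          exact Finset.subset_insert _ _
      have : u = b ↔ w = b := ⟨key u hu w hw hwa, key w hw u hu hua⟩
      simp only [this]
  obtain ⟨a, b, hab, heq⟩ := Finset.card_eq_two.mp he2
  have ha := hlink a b hab heq
  have hb := hlink b a hab.symm (heq.trans (Finset.pair_comm a b))
  have haK : {a} ∈ K.faces := K.down_closed he (by simp [heq]) (by simp)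
  have hbK : {b} ∈ K.faces := K.down_closed he (by simp [heq]) (by simp)
  -- By symmetry the two ends have no other neighbours, so they are the only vertices and the space
  -- lies in a segment. Removing the midpoint disconnects it.
  have hall : ∀ w, {w} ∈ K.faces → w ∈ ({a, b} : Set Plane) := by
    intro w hw
    have hg := hK.eq_of_forall_faces (fun x => x = a ∨ x = b) ?_ haK hw
    · simpa using hg
    · intro s hs x hx y hy
      have key : ∀ x ∈ s, ∀ y ∈ s, x = a ∨ x = b → y = a ∨ y = b := by
        intro x hx y hy hxab
        have hsub : ({x, y} : Finset Plane) ∈ K.faces :=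
          K.down_closed hs (by simp [Finset.insert_subset_iff, hx, hy]) (by simp)
        by_contra! hy'
        rcases hxab with rfl | rfl
        · exact hy'.2 (ha y hsub hy'.1)
        · exact hy'.1 (hb y hsub hy'.2)
      exact propext ⟨key x hx y hy, key y hy x hx⟩
  have hsub := space_subset_convexHull hall
  obtain ⟨φ, hφ⟩ := exists_affineMap_extend (K.indep he) fun x => if x = b then 1 else 0
  have hφa : φ a = 0 := by rw [hφ a (by simp [heq]), if_neg hab]
  have hφb : φ b = 1 := by rw [hφ b (by simp [heq]), if_pos rfl]
  have hφm : φ (midpoint ℝ a b) = 1 / 2 := by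
    rw [midpoint, AffineMap.apply_lineMap, hφa, hφb, AffineMap.lineMap_apply]
    norm_num
  have hpre := ((hK.conn (midpoint ℝ a b)).image φ (continuous_affine φ).continuousOn).ordConnected
  have hma : a ≠ midpoint ℝ a b := fun h => hab ((midpoint_eq_left_iff ℝ).mp h.symm)
  have hmb : b ≠ midpoint ℝ a b := fun h => hab ((midpoint_eq_right_iff ℝ).mp h.symm)
  have hmem : (1 / 2 : ℝ) ∈ φ '' (K.space \ {midpoint ℝ a b}) := by
    refine hpre.out (Set.mem_image_of_mem φ ⟨Geometry.SimplicialComplex.vertices_subset_space haK,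
      hma⟩) (Set.mem_image_of_mem φ ⟨Geometry.SimplicialComplex.vertices_subset_space hbK, hmb⟩) ?_
    rw [hφa, hφb]
    constructor <;> norm_num
  obtain ⟨x, ⟨hx, hxm⟩, hφx⟩ := hmem
  have hxs := hsub hx
  rw [convexHull_pair, segment_eq_image_lineMap] at hxs
  obtain ⟨t, -, rfl⟩ := hxs
  rw [AffineMap.apply_lineMap, hφa, hφb, AffineMap.lineMap_apply] at hφx
  simp only [vsub_eq_sub, sub_zero, smul_eq_mul, mul_one, vadd_eq_add, add_zero] at hφx
  apply hxm
  rw [hφx, midpoint]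
  congr 1
  norm_num

/-! ### Counting simplices around a vertex and along the boundary -/

/-- The faces of dimension `k`. -/
def cells (K : Geometry.SimplicialComplex ℝ Plane) (k : ℕ) : Set (Finset Plane) :=
  {s | s ∈ K.faces ∧ s.card = k + 1}

theorem cells_finite (hfin : K.faces.Finite) (k : ℕ) : (cells K k).Finite :=
  hfin.subset fun _ hs => hs.1

theorem finrank_fun_eq_ncard {C : Set (Finset Plane)} (hC : C.Finite) :
    Module.finrank ℚ (C → ℚ) = C.ncard := by
  have : Finite C := hC
  have := Fintype.ofFinite C
  rw [Module.finrank_fintype_fun_eq_card, ← Nat.card_eq_fintype_card, Nat.card_coe_set_eq]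

open Classical in
/-- Evaluation of a cochain at a simplex, zero outside its domain. -/
noncomputable def evalAt (C : Set (Finset Plane)) (s : Finset Plane) : (C → ℚ) →ₗ[ℚ] ℚ :=
  if h : s ∈ C then LinearMap.proj ⟨s, h⟩ else 0

theorem evalAt_of_mem {C : Set (Finset Plane)} {s : Finset Plane} (h : s ∈ C) (f : C → ℚ) :
    evalAt C s f = f ⟨s, h⟩ := by
  rw [evalAt, dif_pos h]
  rfl

/-- The number of edges at a vertex of a triangulated disk is at most one more than the number of
triangles. -/
theorem IsDiskLike.ncard_edges_le (hK : IsDiskLike K) {v : Plane} (hv : {v} ∈ K.faces) :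
    {e ∈ cells K 1 | v ∈ e}.ncard ≤ {t ∈ cells K 2 | v ∈ t}.ncard + 1 := by
  classical
  set E : Set (Finset Plane) := {e ∈ cells K 1 | v ∈ e} with hE
  set T : Set (Finset Plane) := {t ∈ cells K 2 | v ∈ t} with hT
  have hEfin : E.Finite := (cells_finite hK.finite 1).subset fun _ h => h.1
  have hTfin : T.Finite := (cells_finite hK.finite 2).subset fun _ h => h.1
  have : Finite E := hEfin
  have : Finite T := hTfin
  have hpair : ∀ a, a ≠ v → {v, a} ∈ K.faces → ({v, a} : Finset Plane) ∈ E := fun a ha h =>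
    ⟨⟨h, Finset.card_pair ha.symm⟩, by simp⟩
  have htri : ∀ t : T, ∃ a b, (t : Finset Plane) = {v, a, b} := by
    rintro ⟨t, ⟨ht, ht3⟩, hvt⟩
    obtain ⟨a, b, -, hab⟩ := Finset.card_eq_two.mp
      (by rw [Finset.card_erase_of_mem hvt, ht3] : (t.erase v).card = 2)
    exact ⟨a, b, by rw [← hab, Finset.insert_erase hvt]⟩
  choose α β hαβ using htri
  -- Edges and triangles at `v` are the vertices and edges of its link, and `D` is the coboundary of
  -- that graph. Connectedness of the link makes the kernel at most one-dimensional.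
  let D : (E → ℚ) →ₗ[ℚ] (T → ℚ) :=
    LinearMap.pi fun t => evalAt E {v, α t} - evalAt E {v, β t}
  have hrank := LinearMap.finrank_range_add_finrank_ker D
  have hrange : Module.finrank ℚ (LinearMap.range D) ≤ T.ncard := by
    rw [← finrank_fun_eq_ncard hTfin]
    exact Submodule.finrank_le _
  have hker : Module.finrank ℚ (LinearMap.ker D) ≤ 1 := by
    obtain ⟨a₀, ha₀, hva₀⟩ := hK.exists_edge hv
    have hone : (fun _ => 1 : E → ℚ) ∈ LinearMap.ker D := by
      rw [LinearMap.mem_ker]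
      ext t
      obtain ⟨⟨htK, ht3⟩, hvt⟩ := t.2
      have h3 := hαβ t
      rw [h3] at ht3 htK
      have hc : ∀ u w : Plane, u ∈ ({v, w} : Finset Plane) → ({v, u, w} : Finset Plane).card ≤ 2 := by
        intro u w hu
        rw [Finset.insert_comm, Finset.insert_eq_of_mem hu]
        exact Finset.card_le_two
      have h1 : α t ≠ v := by
        intro h
        have := hc (α t) (β t) (by simp [h])
        omega
      have h2 : β t ≠ v := by
        intro h
        have := hc (β t) (α t) (by simp [h])
        rw [Finset.pair_comm] at this
        omega
      change evalAt E {v, α t} _ - evalAt E {v, β t} _ = 0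
      rw [evalAt_of_mem (hpair _ h1 (K.down_closed htK (by simp [Finset.insert_subset_iff])
          (by simp))), evalAt_of_mem (hpair _ h2 (K.down_closed htK
          (by simp [Finset.insert_subset_iff]) (by simp))), sub_self]
    refine finrank_le_one (⟨_, hone⟩ : LinearMap.ker D) ?_
    rintro ⟨f, hf⟩
    refine ⟨evalAt E {v, a₀} f, Subtype.ext (funext ?_)⟩
    rintro ⟨e, he⟩
    obtain ⟨⟨heK, he2⟩, hve⟩ := id he
    obtain ⟨a, ha⟩ := Finset.card_eq_one.mp
      (by rw [Finset.card_erase_of_mem hve, he2] : (e.erase v).card = 1)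
    have hav : a ≠ v := Finset.ne_of_mem_erase (ha ▸ Finset.mem_singleton_self a)
    have hea : e = {v, a} := by rw [← ha, Finset.insert_erase hve]
    subst hea
    have := link_connected hK.finite hK.lift (hK.conn v) (fun x => evalAt E {v, x} f) ?_
      hva₀ heK ha₀ hav
    · simp only [Submodule.coe_smul, Pi.smul_apply, smul_eq_mul, mul_one]
      rw [this, evalAt_of_mem he]
    · intro s hs hvs x hx y hy hxv hyv
      by_cases hxy : x = y
      · rw [hxy]
      have htT : ({v, x, y} : Finset Plane) ∈ T := by
        refine ⟨⟨K.down_closed hs ?_ (by simp), ?_⟩, by simp⟩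
        · simp [Finset.insert_subset_iff, hvs, hx, hy]
        · exact Finset.card_eq_three.mpr ⟨v, x, y, hxv.symm, hyv.symm, hxy, rfl⟩
      have h0 := congrFun (LinearMap.mem_ker.mp hf) ⟨_, htT⟩
      change evalAt E {v, α ⟨_, htT⟩} f - evalAt E {v, β ⟨_, htT⟩} f = 0 at h0
      have h3 := hαβ ⟨_, htT⟩
      generalize α ⟨_, htT⟩ = p at h0 h3
      generalize β ⟨_, htT⟩ = q at h0 h3
      simp only at h3
      have hx' : x ∈ ({v, p, q} : Finset Plane) := h3 ▸ by simp
      have hy' : y ∈ ({v, p, q} : Finset Plane) := h3 ▸ by simp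
      simp only [Finset.mem_insert, Finset.mem_singleton, hxv, hyv, false_or] at hx' hy'
      have h4 := sub_eq_zero.mp h0
      rcases hx' with rfl | rfl <;> rcases hy' with rfl | rfl
      · rfl
      · exact h4
      · exact h4.symm
      · rfl
  rw [finrank_fun_eq_ncard hEfin] at hrank
  omega

theorem card_edges_at_of_triangle {t : Finset Plane} (ht3 : t.card = 3) {v : Plane} (hv : v ∈ t)
    (E : Finset (Finset Plane)) (hE : ∀ e ⊆ t, e.card = 2 → e ∈ E)
    (hE2 : ∀ e ∈ E, e.card = 2) [DecidablePred fun e : Finset Plane => v ∈ e ∧ e ⊆ t] :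
    (E.filter fun e => v ∈ e ∧ e ⊆ t).card = 2 := by
  classical
  have h : (E.filter fun e => v ∈ e ∧ e ⊆ t) = (t.erase v).image fun a => {v, a} := by
    ext e
    simp only [Finset.mem_filter, Finset.mem_image]
    constructor
    · rintro ⟨he, hve, het⟩
      obtain ⟨a, ha⟩ := Finset.card_eq_one.mp
        (by rw [Finset.card_erase_of_mem hve, hE2 e he] : (e.erase v).card = 1)
      have hae : a ∈ e.erase v := ha ▸ Finset.mem_singleton_self a
      exact ⟨a, Finset.erase_subset_erase v het hae, by rw [← ha, Finset.insert_erase hve]⟩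
    · rintro ⟨a, ha, rfl⟩
      have hav := Finset.ne_of_mem_erase ha
      have hsub : ({v, a} : Finset Plane) ⊆ t := by
        simp [Finset.insert_subset_iff, hv, Finset.mem_of_mem_erase ha]
      exact ⟨hE _ hsub (Finset.card_pair hav.symm), by simp, hsub⟩
  rw [h, Finset.card_image_of_injOn, Finset.card_erase_of_mem hv, ht3]
  intro a ha b hb hab
  have h1 : a ∈ ({v, b} : Finset Plane) := by
    have hab' : ({v, a} : Finset Plane) = {v, b} := hab
    rw [← hab']
    simp
  simpa [Finset.ne_of_mem_erase ha] using h1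

/-- An edge lies in at most two triangles. -/
theorem card_triangles_at_le_two {e : Finset Plane} (he2 : e.card = 2)
    (T : Finset (Finset Plane)) (hT : ∀ t ∈ T, t ∈ K.faces ∧ t.card = 3 ∧ e ⊆ t) :
    T.card ≤ 2 := by
  by_contra! h
  obtain ⟨t₁, h₁, t₂, h₂, t₃, h₃, h₁₂, h₁₃, h₂₃⟩ := Finset.two_lt_card.mp h
  obtain ⟨hK₁, hc₁, he₁⟩ := hT t₁ h₁
  obtain ⟨hK₂, hc₂, he₂⟩ := hT t₂ h₂
  obtain ⟨hK₃, hc₃, he₃⟩ := hT t₃ h₃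
  classical
  obtain ⟨a, ha, hat⟩ := exists_insert_eq he₁ he2 hc₁
  obtain ⟨b, hb, hbt⟩ := exists_insert_eq he₂ he2 hc₂
  obtain ⟨c, hc, hct⟩ := exists_insert_eq he₃ he2 hc₃
  have hab : a ≠ b := fun h => h₁₂ (by rw [← hat, ← hbt, h])
  have hac : a ≠ c := fun h => h₁₃ (by rw [← hat, ← hct, h])
  have hbc : b ≠ c := fun h => h₂₃ (by rw [← hbt, ← hct, h])
  -- Of three apexes, any two would be on opposite sides of the edge; but being opposite twice means
  -- being on the same side.
  have n₁ := coord_opposite_neg hK₁ hK₂ hc₁ hc₂ ha hb hat hbt hab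
  have n₂ := coord_opposite_neg hK₁ hK₃ hc₁ hc₃ ha hc hat hct hac
  have n₃ := coord_opposite_neg hK₂ hK₃ hc₂ hc₃ hb hc hbt hct hbc
  rw [coord_eq_mul_coord (K.indep hK₁) (K.indep hK₂) hc₂ ha hb hat hbt] at n₂
  exact absurd (mul_pos_of_neg_of_neg n₁ n₃) (not_lt.mpr n₂.le)

/-- In a triangulated disk, the number of triangles at an edge is two minus the number of times it
occurs in the boundary. -/
theorem IsDiskLike.card_triangles_at_edge (hK : IsDiskLike K) {e : Finset Plane}
    (he : e ∈ K.faces) (he2 : e.card = 2) (T : Finset (Finset Plane))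
    (hT : ∀ t, t ∈ T ↔ t ∈ K.faces ∧ t.card = 3 ∧ e ⊆ t)
    [Decidable (e ∈ (boundary K).faces)] :
    T.card + (if e ∈ (boundary K).faces then 1 else 0) = 2 := by
  have hle := card_triangles_at_le_two he2 T fun t ht => (hT t).mp ht
  obtain ⟨t, ht, ht3, het⟩ := hK.exists_triangle he he2
  have htT : t ∈ T := (hT t).mpr ⟨ht, ht3, het⟩
  have hpos : 0 < T.card := Finset.card_pos.mpr ⟨t, htT⟩
  rcases (by omega : T.card = 1 ∨ T.card = 2) with h | h
  · obtain ⟨t₀, ht₀⟩ := Finset.card_eq_one.mp h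
    have hmem : e ∈ (boundary K).faces := by
      refine ⟨he, edge_subset_frontier hK.finite he he2 ht ht3 het fun t' h1 h2 h3 => ?_⟩
      have h4 : t' ∈ T := (hT t').mpr ⟨h1, h2, h3⟩
      rw [ht₀, Finset.mem_singleton] at h4 htT
      rw [h4, htT]
    rw [if_pos hmem, h]
  · obtain ⟨t₁, t₂, hne, hTe⟩ := Finset.card_eq_two.mp h
    obtain ⟨a1, a2, a3⟩ := (hT t₁).mp (by simp [hTe])
    obtain ⟨b1, b2, b3⟩ := (hT t₂).mp (by simp [hTe])
    rw [if_neg fun hm => not_edge_subset_frontier he2 a1 b1 a2 b2 a3 b3 hne hm.2, h]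

theorem cells_boundary_subset (k : ℕ) : cells (boundary K) k ⊆ cells K k :=
  fun _ hs => ⟨hs.1.1, hs.2⟩

/-- A boundary vertex of a triangulated disk lies on two boundary edges. -/
theorem IsDiskLike.card_boundary_edges_at (hK : IsDiskLike K) {v : Plane}
    (hv : {v} ∈ (boundary K).faces) (B : Finset (Finset Plane))
    (hB : ∀ e, e ∈ B ↔ e ∈ cells (boundary K) 1 ∧ v ∈ e) : B.card = 2 := by
  classical
  let E : Finset (Finset Plane) := (cells_finite hK.finite 1).toFinset
  let T : Finset (Finset Plane) := (cells_finite hK.finite 2).toFinset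
  have hE : ∀ e, e ∈ E ↔ e ∈ cells K 1 := fun e => Set.Finite.mem_toFinset _
  have hT : ∀ t, t ∈ T ↔ t ∈ cells K 2 := fun t => Set.Finite.mem_toFinset _
  let Ev := E.filter (v ∈ ·)
  let Tv := T.filter (v ∈ ·)
  have hdouble : ∑ e ∈ Ev, (T.filter fun t => e ⊆ t).card = 2 * Tv.card := by
    have h1 := Finset.sum_card_bipartiteAbove_eq_sum_card_bipartiteBelow
      (s := Ev) (t := T) (fun e t : Finset Plane => e ⊆ t)
    simp only [Finset.bipartiteAbove, Finset.bipartiteBelow] at h1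
    rw [h1, mul_comm, ← smul_eq_mul, ← Finset.sum_const, Finset.sum_filter]
    refine Finset.sum_congr rfl fun t ht => ?_
    obtain ⟨htK, ht3⟩ := (hT t).mp ht
    rw [Finset.filter_filter]
    split_ifs with hvt
    · refine card_edges_at_of_triangle ht3 hvt E (fun e he he2 => (hE e).mpr ⟨?_, he2⟩)
        fun e he => ((hE e).mp he).2
      exact K.down_closed htK he (Finset.card_pos.mp (by omega))
    · exact Finset.card_eq_zero.mpr (Finset.filter_eq_empty_iff.mpr
        fun e _ h => hvt (h.2 h.1))
  have hcount : ∀ e ∈ Ev, (T.filter fun t => e ⊆ t).card +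
      (if e ∈ (boundary K).faces then 1 else 0) = 2 := by
    intro e he
    obtain ⟨heE, hve⟩ := Finset.mem_filter.mp he
    obtain ⟨heK, he2⟩ := (hE e).mp heE
    refine hK.card_triangles_at_edge heK he2 _ fun t => ?_
    rw [Finset.mem_filter, hT]
    exact and_assoc
  -- This makes `B.card` even; `hle` then bounds it by 2 and `hne` excludes 0.
  have hsum : 2 * Tv.card + B.card = 2 * Ev.card := by
    have hBE : B = Ev.filter (· ∈ (boundary K).faces) := by
      ext e
      rw [hB, Finset.mem_filter, Finset.mem_filter, hE]
      exact ⟨fun h => ⟨⟨cells_boundary_subset 1 h.1, h.2⟩, h.1.1⟩,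
        fun h => ⟨⟨h.2, h.1.1.2⟩, h.1.2⟩⟩
    rw [← hdouble, hBE, Finset.card_filter, ← Finset.sum_add_distrib, Finset.sum_congr rfl hcount,
      Finset.sum_const, smul_eq_mul, mul_comm]
  have hle : Ev.card ≤ Tv.card + 1 := by
    have h1 := hK.ncard_edges_le hv.1
    have h2 : {e ∈ cells K 1 | v ∈ e} = (Ev : Set (Finset Plane)) := by
      ext e
      simp [Ev, hE]
    have h3 : {t ∈ cells K 2 | v ∈ t} = (Tv : Set (Finset Plane)) := by
      ext t
      simp [Tv, hT]
    rwa [h2, h3, Set.ncard_coe_finset, Set.ncard_coe_finset] at h1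
  have hne : B.card ≠ 0 := by
    intro h0
    obtain ⟨a, hav, haK⟩ := hK.exists_edge hv.1
    obtain ⟨t₀, ht₀, ht₀3, hsub⟩ := hK.exists_triangle haK (Finset.card_pair hav.symm)
    refine (hv.2 (show v ∈ convexHull ℝ (({v} : Finset Plane) : Set Plane) by simp)).2
      (vertex_mem_interior hK.finite ht₀ ht₀3 (hsub (by simp)) ?_)
    intro t ht ht3 e het he2 hve
    have heK : e ∈ K.faces := K.down_closed ht het (Finset.card_pos.mp (by omega))
    have h1 := hcount e (Finset.mem_filter.mpr ⟨(hE e).mpr ⟨heK, he2⟩, hve⟩)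
    have h2 : e ∉ (boundary K).faces := by
      intro h
      have : e ∈ B := (hB e).mpr ⟨⟨h, he2⟩, hve⟩
      rw [Finset.card_eq_zero.mp h0] at this
      exact absurd this (Finset.notMem_empty e)
    rw [if_neg h2, add_zero] at h1
    obtain ⟨t', ht', hne⟩ := Finset.exists_mem_ne (by omega : 1 < (T.filter fun t => e ⊆ t).card) t
    obtain ⟨ht'T, het'⟩ := Finset.mem_filter.mp ht'
    obtain ⟨h3, h4⟩ := (hT t').mp ht'T
    exact ⟨t', h3, h4, hne, het'⟩
  omega

/-- The boundary of a triangulated disk has as many vertices as edges. -/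
theorem IsDiskLike.ncard_boundary (hK : IsDiskLike K) :
    (cells (boundary K) 0).ncard = (cells (boundary K) 1).ncard := by
  classical
  have hfin : ∀ k, (cells (boundary K) k).Finite := fun k =>
    (cells_finite hK.finite k).subset (cells_boundary_subset k)
  let V := (hfin 0).toFinset
  let E := (hfin 1).toFinset
  have hV : ∀ e, e ∈ V ↔ e ∈ cells (boundary K) 0 := fun e => Set.Finite.mem_toFinset _
  have hE : ∀ e, e ∈ E ↔ e ∈ cells (boundary K) 1 := fun e => Set.Finite.mem_toFinset _
  have h1 := Finset.sum_card_bipartiteAbove_eq_sum_card_bipartiteBelow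
    (s := V) (t := E) (fun v e : Finset Plane => v ⊆ e)
  have h2 : ∀ s ∈ V, (E.bipartiteAbove (fun v e : Finset Plane => v ⊆ e) s).card = 2 := by
    intro s hs
    obtain ⟨hsK, hs1⟩ := (hV s).mp hs
    obtain ⟨v, rfl⟩ := Finset.card_eq_one.mp hs1
    refine hK.card_boundary_edges_at hsK _ fun e => ?_
    rw [Finset.mem_bipartiteAbove, hE, Finset.singleton_subset_iff]
  have h3 : ∀ e ∈ E, (V.bipartiteBelow (fun v e : Finset Plane => v ⊆ e) e).card = 2 := by
    intro e he
    obtain ⟨heK, he2⟩ := (hE e).mp he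
    have : V.bipartiteBelow (fun v e : Finset Plane => v ⊆ e) e = e.image fun v => {v} := by
      ext s
      rw [Finset.mem_bipartiteBelow, hV, Finset.mem_image]
      constructor
      · rintro ⟨⟨-, hs1⟩, hse⟩
        obtain ⟨v, rfl⟩ := Finset.card_eq_one.mp hs1
        exact ⟨v, Finset.singleton_subset_iff.mp hse, rfl⟩
      · rintro ⟨v, hv, rfl⟩
        have hve := Finset.singleton_subset_iff.mpr hv
        exact ⟨⟨(boundary K).down_closed heK hve (by simp), Finset.card_singleton v⟩, hve⟩
    rw [this, Finset.card_image_of_injective _ Finset.singleton_injective, he2]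
  rw [Finset.sum_congr rfl h2, Finset.sum_congr rfl h3, Finset.sum_const, Finset.sum_const,
    smul_eq_mul, smul_eq_mul] at h1
  rw [Set.ncard_eq_toFinset_card _ (hfin 0), Set.ncard_eq_toFinset_card _ (hfin 1)]
  exact Nat.eq_of_mul_eq_mul_right two_pos h1

theorem cells_boundary_two : cells (boundary K) 2 = ∅ :=
  Set.eq_empty_of_forall_notMem fun _ ht => not_triangle_subset_frontier ht.1.1 ht.2 ht.1.2

/-! ### The rational cochain complex and the Euler characteristic -/

/-- There is an antisymmetric choice of signs on pairs of points. -/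
theorem exists_sign : ∃ σ : Plane → Plane → ℚ,
    (∀ x y, σ y x = - σ x y) ∧ ∀ x y, x ≠ y → σ x y * σ x y = 1 := by
  classical
  let r : Plane → Plane → Prop := WellOrderingRel
  refine ⟨fun x y => if r x y then 1 else if r y x then -1 else 0, fun x y => ?_, fun x y h => ?_⟩
  · by_cases h1 : r x y <;> by_cases h2 : r y x
    · exact absurd h2 (asymm_of r h1)
    all_goals simp [h1, h2]
  · rcases trichotomous_of r x y with h1 | h1 | h1
    · simp [h1]
    · exact absurd h1 h
    · simp [h1, asymm_of r h1]

/-- The Euler characteristic of a triangulated disk is one. -/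
theorem IsDiskLike.euler (hK : IsDiskLike K) :
    (cells K 0).ncard + (cells K 2).ncard = (cells K 1).ncard + 1 := by
  classical
  obtain ⟨σ, hσ, hσ1⟩ := exists_sign
  have hfin := cells_finite hK.finite
  have hF : ∀ k, Finite (cells K k) := fun k => hfin k
  have hedge : ∀ e : cells K 1, ∃ x y, x ≠ y ∧ (e : Finset Plane) = {x, y} := fun e =>
    Finset.card_eq_two.mp e.2.2
  have htri : ∀ t : cells K 2, ∃ a b d, a ≠ b ∧ a ≠ d ∧ b ≠ d ∧ (t : Finset Plane) = {a, b, d} :=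
    fun t => Finset.card_eq_three.mp t.2.2
  choose ξ η hξη heq using hedge
  choose α β δ hαβ hαδ hβδ hteq using htri
  let pot : (cells K 0 → ℚ) → Plane → ℚ := fun g x => evalAt (cells K 0) {x} g
  -- Cochains are indexed by unordered edges; `σ` orients them, and `ext` is the resulting
  -- antisymmetric function on ordered pairs. `D₀` and `D₁` are the simplicial coboundaries in these
  -- terms.
  let ext : (cells K 1 → ℚ) → Plane → Plane → ℚ := fun c x y => σ x y * evalAt (cells K 1) {x, y} c
  let D₀ : (cells K 0 → ℚ) →ₗ[ℚ] (cells K 1 → ℚ) := LinearMap.pi fun e =>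
    σ (ξ e) (η e) • (evalAt (cells K 0) {η e} - evalAt (cells K 0) {ξ e})
  let D₁ : (cells K 1 → ℚ) →ₗ[ℚ] (cells K 2 → ℚ) := LinearMap.pi fun t =>
    σ (α t) (β t) • evalAt (cells K 1) {α t, β t} + σ (β t) (δ t) • evalAt (cells K 1) {β t, δ t}
      - σ (α t) (δ t) • evalAt (cells K 1) {α t, δ t}
  have hD₀ : ∀ g e, D₀ g e = σ (ξ e) (η e) * (pot g (η e) - pot g (ξ e)) := fun g e => rfl
  have hD₁ : ∀ c t, D₁ c t = ext c (α t) (β t) + ext c (β t) (δ t) - ext c (α t) (δ t) :=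
    fun c t => rfl
  have hanti : ∀ c x y, ext c y x = - ext c x y := by
    intro c x y
    simp only [ext]
    rw [hσ, Finset.pair_comm, neg_mul]
  have hself : ∀ c x, ext c x x = 0 := fun c x => self_eq_neg.mp (hanti c x x)
  have hmem₁ : ∀ x y, x ≠ y → ({x, y} : Finset Plane) ∈ K.faces →
      ({x, y} : Finset Plane) ∈ cells K 1 := fun x y h hK => ⟨hK, Finset.card_pair h⟩
  have hcob : ∀ g x y, x ≠ y → ({x, y} : Finset Plane) ∈ K.faces →
      ext (D₀ g) x y = pot g y - pot g x := by
    intro g x y hxy hxyK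
    have hm := hmem₁ x y hxy hxyK
    simp only [ext]
    rw [evalAt_of_mem hm, hD₀]
    have h1 := heq ⟨_, hm⟩
    have h2 := hξη ⟨_, hm⟩
    generalize ξ ⟨_, hm⟩ = p at h1 h2
    generalize η ⟨_, hm⟩ = q at h1 h2
    simp only at h1
    have hp : x ∈ ({p, q} : Finset Plane) := h1 ▸ by simp
    have hq : y ∈ ({p, q} : Finset Plane) := h1 ▸ by simp
    simp only [Finset.mem_insert, Finset.mem_singleton] at hp hq
    rcases hp with rfl | rfl <;> rcases hq with rfl | rfl
    · exact absurd rfl hxy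
    · rw [← mul_assoc, hσ1 _ _ hxy, one_mul]
    · rw [hσ y x]
      linear_combination (pot g y - pot g x) * hσ1 y x h2
    · exact absurd rfl hxy
  have hcocycle : ∀ c, D₁ c = 0 → ∀ s ∈ K.faces, ∀ a ∈ s, ∀ b ∈ s, ∀ d ∈ s,
      ext c a b + ext c b d = ext c a d := by
    intro c hc s hs a ha b hb d hd
    by_cases hab : a = b
    · rw [hab, hself, zero_add]
    by_cases hbd : b = d
    · rw [hbd, hself, add_zero]
    by_cases had : a = d
    · rw [had, hself, hanti c d b, add_neg_cancel]
    have hm : ({a, b, d} : Finset Plane) ∈ cells K 2 :=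
      ⟨K.down_closed hs (by simp [Finset.insert_subset_iff, ha, hb, hd]) (by simp),
        Finset.card_eq_three.mpr ⟨a, b, d, hab, had, hbd, rfl⟩⟩
    have h0 := congrFun hc ⟨_, hm⟩
    rw [hD₁] at h0
    have h1 := hteq ⟨_, hm⟩
    generalize α ⟨_, hm⟩ = p at h0 h1
    generalize β ⟨_, hm⟩ = q at h0 h1
    generalize δ ⟨_, hm⟩ = r at h0 h1
    simp only at h1
    have ha' : a ∈ ({p, q, r} : Finset Plane) := h1 ▸ by simp
    have hb' : b ∈ ({p, q, r} : Finset Plane) := h1 ▸ by simp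
    have hd' : d ∈ ({p, q, r} : Finset Plane) := h1 ▸ by simp
    simp only [Finset.mem_insert, Finset.mem_singleton] at ha' hb' hd'
    have e1 := hanti c p q
    have e2 := hanti c q r
    have e3 := hanti c p r
    simp only [Pi.zero_apply] at h0
    rcases ha' with rfl | rfl | rfl <;> rcases hb' with rfl | rfl | rfl <;>
      rcases hd' with rfl | rfl | rfl <;>
      first
      | exact absurd rfl hab
      | exact absurd rfl hbd
      | exact absurd rfl had
      | linarith
  have hrange₀ : LinearMap.range D₀ = LinearMap.ker D₁ := by
    apply le_antisymm
    · rintro _ ⟨g, rfl⟩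
      rw [LinearMap.mem_ker]
      funext t
      have hsub : ∀ x y, x ≠ y → x ∈ (t : Finset Plane) → y ∈ (t : Finset Plane) →
          ext (D₀ g) x y = pot g y - pot g x := fun x y hxy hx hy =>
        hcob g x y hxy (K.down_closed t.2.1 (by simp [Finset.insert_subset_iff, hx, hy]) (by simp))
      have ha : α t ∈ (t : Finset Plane) := by rw [hteq t]; simp
      have hb : β t ∈ (t : Finset Plane) := by rw [hteq t]; simp
      have hd : δ t ∈ (t : Finset Plane) := by rw [hteq t]; simp
      rw [hD₁, hsub _ _ (hαβ t) ha hb, hsub _ _ (hβδ t) hb hd, hsub _ _ (hαδ t) ha hd,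
        Pi.zero_apply]
      ring
    · intro c hc
      obtain ⟨g, hg⟩ := exists_potential hK.finite hK.lift (ext c) (hcocycle c hc)
      -- Each `s` is a singleton, so the sum is the value of `g` at its vertex.
      refine ⟨fun s => ∑ x ∈ (s : Finset Plane), g x, funext fun e => ?_⟩
      have hx : {ξ e} ∈ K.faces := K.down_closed e.2.1 (by rw [heq e]; simp) (by simp)
      have hy : {η e} ∈ K.faces := K.down_closed e.2.1 (by rw [heq e]; simp) (by simp)
      have h1 := hg e e.2.1 (ξ e) (by rw [heq e]; simp) (η e) (by rw [heq e]; simp)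
      have hm : ({ξ e, η e} : Finset Plane) ∈ cells K 1 := heq e ▸ e.2
      rw [hD₀]
      simp only [pot, ext] at h1 ⊢
      rw [evalAt_of_mem (C := cells K 0) (s := {η e}) ⟨hy, Finset.card_singleton _⟩,
        evalAt_of_mem (C := cells K 0) (s := {ξ e}) ⟨hx, Finset.card_singleton _⟩,
        Finset.sum_singleton, Finset.sum_singleton, ← h1, ← mul_assoc, hσ1 _ _ (hξη e), one_mul,
        evalAt_of_mem hm]
      congr 1
      exact Subtype.ext (heq e).symm
  have hker₀ : Module.finrank ℚ (LinearMap.ker D₀) = 1 := by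
    have hone : (fun _ => 1 : cells K 0 → ℚ) ∈ LinearMap.ker D₀ := by
      rw [LinearMap.mem_ker]
      funext e
      have hx : {ξ e} ∈ K.faces := K.down_closed e.2.1 (by rw [heq e]; simp) (by simp)
      have hy : {η e} ∈ K.faces := K.down_closed e.2.1 (by rw [heq e]; simp) (by simp)
      rw [hD₀]
      simp only [pot]
      rw [evalAt_of_mem (C := cells K 0) (s := {η e}) ⟨hy, Finset.card_singleton _⟩,
        evalAt_of_mem (C := cells K 0) (s := {ξ e}) ⟨hx, Finset.card_singleton _⟩, sub_self,
        mul_zero, Pi.zero_apply]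
    obtain ⟨x₀, hx₀⟩ := hK.nontrivial.nonempty
    obtain ⟨s₀, hs₀, -⟩ := Geometry.SimplicialComplex.mem_space_iff.mp hx₀
    obtain ⟨v₀, hv₀⟩ := K.nonempty_of_mem_faces hs₀
    have hv₀K : {v₀} ∈ K.faces := K.down_closed hs₀ (by simpa using hv₀) (by simp)
    rw [finrank_eq_one_iff']
    refine ⟨⟨_, hone⟩, fun h => ?_, ?_⟩
    · have := congrFun (congrArg Subtype.val h) ⟨{v₀}, hv₀K, Finset.card_singleton v₀⟩
      exact one_ne_zero this
    · rintro ⟨g, hg⟩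
      refine ⟨pot g v₀, Subtype.ext (funext ?_)⟩
      rintro ⟨s, hs⟩
      obtain ⟨v, rfl⟩ := Finset.card_eq_one.mp hs.2
      have hpot : pot g v₀ = pot g v := by
        refine hK.eq_of_forall_faces (pot g) (fun s hs a ha b hb => ?_) hv₀K hs.1
        by_cases hab : a = b
        · rw [hab]
        have h1 := hcob g a b hab
          (K.down_closed hs (by simp [Finset.insert_subset_iff, ha, hb]) (by simp))
        rw [LinearMap.mem_ker.mp hg] at h1
        simp only [ext, map_zero, mul_zero] at h1
        linarith
      simp only [Submodule.coe_smul, Pi.smul_apply, smul_eq_mul, mul_one]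
      rw [hpot]
      exact evalAt_of_mem hs g
  have hrange₁ : LinearMap.range D₁ = ⊤ := by
    by_contra hne
    obtain ⟨φ, hφ, hle⟩ := Submodule.exists_le_ker_of_lt_top _ (lt_top_iff_ne_top.mpr hne)
    have := Fintype.ofFinite (cells K 2)
    -- A functional vanishing on the range of `D₁` is a 2-cycle `z`. Its support `Z` will have no
    -- free edge, which is impossible in the plane.
    let z : cells K 2 → ℚ := fun t => φ (Pi.single t 1)
    have hφz : ∀ f, φ f = ∑ t, f t * z t := by
      intro f
      conv_lhs => rw [← Finset.univ_sum_single f]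
      rw [map_sum]
      refine Finset.sum_congr rfl fun t _ => ?_
      rw [← smul_eq_mul, ← map_smul, ← Pi.single_smul, smul_eq_mul, mul_one]
    let Z : Set (Finset Plane) := {s | ∃ h : s ∈ cells K 2, z ⟨s, h⟩ ≠ 0}
    refine not_forall_edge_exists_ne (K := K) (Z := Z) ((hfin 2).subset fun s hs => hs.1)
      (fun t ht => ht.1) ?_ ?_
    · by_contra hZ
      apply hφ
      refine LinearMap.ext fun f => ?_
      rw [hφz, LinearMap.zero_apply]
      refine Finset.sum_eq_zero fun t _ => ?_
      have : z t = 0 := by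
        by_contra h
        exact hZ ⟨t, t.2, h⟩
      rw [this, mul_zero]
    · rintro t ⟨ht, hzt⟩ e het he2
      have heK : e ∈ cells K 1 := ⟨K.down_closed ht.1 het (Finset.card_pos.mp (by omega)), he2⟩
      by_contra! hno
      -- The coboundary of the indicator of `e` is supported on the triangles containing `e`. If `t`
      -- were the only one in `Z`, pairing it with `z` would leave a nonzero multiple of `z t`.
      have h0 : φ (D₁ (Pi.single ⟨e, heK⟩ 1)) = 0 := hle ⟨_, rfl⟩
      have hval : ∀ x y, ({x, y} : Finset Plane) ≠ e → ext (Pi.single ⟨e, heK⟩ 1) x y = 0 := by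
        intro x y hxy
        simp only [ext]
        by_cases hm : ({x, y} : Finset Plane) ∈ cells K 1
        · rw [evalAt_of_mem hm, Pi.single_eq_of_ne, mul_zero]
          exact fun h => hxy (congrArg Subtype.val h)
        · rw [evalAt, dif_neg hm, LinearMap.zero_apply, mul_zero]
      have hval1 : ∀ x y, x ≠ y → ({x, y} : Finset Plane) = e →
          ext (Pi.single ⟨e, heK⟩ 1) x y ≠ 0 := by
        rintro x y hxy rfl
        simp only [ext]
        rw [evalAt_of_mem heK, Pi.single_eq_same, mul_one]
        intro h
        have := hσ1 x y hxy
        rw [h, mul_zero] at this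
        exact zero_ne_one this
      rw [hφz, Finset.sum_eq_single ⟨t, ht⟩] at h0
      · refine hzt ((mul_eq_zero.mp h0).resolve_left ?_)
        rw [hD₁]
        have hteq' := hteq ⟨t, ht⟩
        have h1 := hαβ ⟨t, ht⟩
        have h2 := hβδ ⟨t, ht⟩
        have h3 := hαδ ⟨t, ht⟩
        generalize α ⟨t, ht⟩ = a at hteq' h1 h2 h3
        generalize β ⟨t, ht⟩ = b at hteq' h1 h2 h3
        generalize δ ⟨t, ht⟩ = d at hteq' h1 h2 h3
        simp only at hteq'
        have hdist : ∀ x y w : Plane, w ∈ ({x, y} : Finset Plane) → w ∉ e →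
            ext (Pi.single ⟨e, heK⟩ 1) x y = 0 := fun x y w hw hwe =>
          hval x y fun h => hwe (h ▸ hw)
        obtain ⟨w, hwe, hwt⟩ := exists_insert_eq het he2 ht.2
        have hw : w ∈ ({a, b, d} : Finset Plane) := by
          rw [← hteq', ← hwt]
          simp
        have herase : e = ({a, b, d} : Finset Plane).erase w := by
          rw [← hteq', ← hwt, Finset.erase_insert hwe]
        simp only [Finset.mem_insert, Finset.mem_singleton] at hw
        rcases hw with rfl | rfl | rfl
        · rw [hdist w b w (by simp) hwe, hdist w d w (by simp) hwe, zero_add, sub_zero]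
          refine hval1 b d h2 ?_
          rw [herase, Finset.erase_insert (by simp [h1, h3])]
        · rw [hdist a w w (by simp) hwe, hdist w d w (by simp) hwe, zero_add, zero_sub,
            neg_eq_zero]
          refine hval1 a d h3 ?_
          rw [herase, Finset.insert_comm, Finset.erase_insert (by simp [h1.symm, h2])]
        · rw [hdist b w w (by simp) hwe, hdist a w w (by simp) hwe, add_zero, sub_zero]
          refine hval1 a b h1 ?_
          rw [herase, Finset.pair_comm b w, Finset.insert_comm,
            Finset.erase_insert (by simp [h3.symm, h2.symm])]
      · intro t' _ hne'
        by_cases hz : z t' = 0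
        · rw [hz, mul_zero]
        have hnsub : ¬ e ⊆ (t' : Finset Plane) :=
          hno t' ⟨t'.2, hz⟩ fun h => hne' (Subtype.ext h)
        have hz' : ∀ x y, x ∈ (t' : Finset Plane) → y ∈ (t' : Finset Plane) →
            ext (Pi.single ⟨e, heK⟩ 1) x y = 0 := fun x y hx hy =>
          hval x y fun h => hnsub (h ▸ by simp [Finset.insert_subset_iff, hx, hy])
        have ha : α t' ∈ (t' : Finset Plane) := by rw [hteq t']; simp
        have hb : β t' ∈ (t' : Finset Plane) := by rw [hteq t']; simp
        have hd : δ t' ∈ (t' : Finset Plane) := by rw [hteq t']; simp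
        rw [hD₁, hz' _ _ ha hb, hz' _ _ hb hd, hz' _ _ ha hd, add_zero, sub_zero, zero_mul]
      · exact fun h => absurd (Finset.mem_univ _) h
  -- Rank-nullity for both maps shares the dimension of `ker D₁ = range D₀`, which is eliminated at
  -- the end.
  have r0 := LinearMap.finrank_range_add_finrank_ker D₀
  have r1 := LinearMap.finrank_range_add_finrank_ker D₁
  rw [finrank_fun_eq_ncard (hfin 0), hker₀, hrange₀] at r0
  rw [finrank_fun_eq_ncard (hfin 1), hrange₁, finrank_top, finrank_fun_eq_ncard (hfin 2)] at r1
  omega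

/-! ### Effect of the identifications -/

/-- By `I.mem_faces`, a simplex off the boundary is equivalent only to itself. Such simplices
therefore contribute one class each, disjoint from the boundary classes. -/
theorem numSimplices_eq (hfin : K.faces.Finite) (I : Identification (boundary K)) (k : ℕ) :
    (numSimplices K I.simplexSetoid k : ℤ) = numSimplices (boundary K) I.simplexSetoid k +
      ((cells K k).ncard - (cells (boundary K) k).ncard) := by
  have hK := cells_finite hfin k
  have hsub := cells_boundary_subset (K := K) k
  have hrel : ∀ s ∈ cells K k \ cells (boundary K) k, ∀ t : Finset Plane,
      Quotient.mk I.simplexSetoid s = Quotient.mk I.simplexSetoid t → s = t := by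
    rintro s ⟨hs, hs'⟩ t h
    rcases Quotient.exact h with h | ⟨n, v, w, hv, -, hvw⟩
    · exact h
    · exact absurd ⟨hv ▸ I.mem_faces hvw, hs.2⟩ hs'
  have hunion : Quotient.mk I.simplexSetoid '' cells K k =
      Quotient.mk I.simplexSetoid '' cells (boundary K) k ∪
        Quotient.mk I.simplexSetoid '' (cells K k \ cells (boundary K) k) := by
    rw [← Set.image_union, Set.union_sdiff_cancel hsub]
  have hdisj : Disjoint (Quotient.mk I.simplexSetoid '' cells (boundary K) k)
      (Quotient.mk I.simplexSetoid '' (cells K k \ cells (boundary K) k)) := by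
    rw [Set.disjoint_left]
    rintro _ ⟨s, hs, rfl⟩ ⟨t, ht, hts⟩
    exact ht.2 (hrel t ht s hts ▸ hs)
  have hcard : (Quotient.mk I.simplexSetoid '' cells K k).ncard =
      (Quotient.mk I.simplexSetoid '' cells (boundary K) k).ncard +
        (cells K k \ cells (boundary K) k).ncard := by
    rw [hunion, Set.ncard_union_eq hdisj ((hK.subset hsub).image _)
      ((hK.subset Set.sdiff_subset).image _),
      Set.InjOn.ncard_image (s := cells K k \ cells (boundary K) k)
        fun s hs t _ h => hrel s hs t h]
  have hdiff := Set.ncard_sdiff_add_ncard_of_subset hsub hK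
  change ((Quotient.mk I.simplexSetoid '' cells K k).ncard : ℤ) =
    ((Quotient.mk I.simplexSetoid '' cells (boundary K) k).ncard : ℤ) + _
  omega

end PlanarComplex

theorem mainTheorem1 (K : Geometry.SimplicialComplex ℝ Plane) (hfin : K.faces.Finite)
    (hdisc : Nonempty (K.space ≃ₜ Metric.closedBall (0 : Plane) 1))
    (I : PlanarComplex.Identification (PlanarComplex.boundary K)) :
    PlanarComplex.eulerChar K I.simplexSetoid =
      PlanarComplex.eulerChar (PlanarComplex.boundary K) I.simplexSetoid + 1 := by
  obtain ⟨h⟩ := hdisc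
  have hK := PlanarComplex.IsDiskLike.of_homeomorph hfin h
  have h1 := hK.euler
  have h2 := hK.ncard_boundary
  have h3 : (PlanarComplex.cells (PlanarComplex.boundary K) 2).ncard = 0 := by
    rw [PlanarComplex.cells_boundary_two, Set.ncard_empty]
  rw [PlanarComplex.eulerChar, PlanarComplex.eulerChar, PlanarComplex.numSimplices_eq hfin I 0,
    PlanarComplex.numSimplices_eq hfin I 1, PlanarComplex.numSimplices_eq hfin I 2]
  omega
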